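/- Fix $d,T\in\mathbb N$ with $T\ge 1$, reals $D>0$, $G>0$, $\mathfrak p\in(1,2]$ and $0<\sigma_{\mathfrak s}\le\sigma_{\mathfrak l}$, and let $d_{\mathrm{eff}}=\sigma_{\mathfrak l}^2/\sigma_{\mathfrak s}^2$. Let $\mathfrak f_G$ be the set of convex functions $f:\mathbb R^d\to\mathbb R$ that are $G$-Lipschitz for the Euclidean norm, and let $\mathfrak F_{D,G}$ be the set of $F\in\mathfrak f_G$ with $\inf\{\|x_\star\| : x_\star\in\operatorname{argmin}_{\mathbb R^d}F\}\le D$ (where $\inf\emptyset=+\infty$); write $F_\star=\inf_{\mathbb R^d}F$. Let $\mathfrak G$ be the set of stochastic first-order oracles $\mathbf g$: for every $f\in\mathfrak f_G$ and $x\in\mathbb R^d$ the answer $\mathbf g(x,f)$ is an integrable random vector in $\mathbb R^d$, whose law depends measurably on $x$, with $\mathbb E[\mathbf g(x,f)]=:\nabla f(x)\in\partial f(x)$, with $\mathbb E[|\langle e,\mathbf g(x,f)-\nabla f(x)\rangle|^{\mathfrak p}]\le\sigma_{\mathfrak s}^{\mathfrak p}$ for every unit vector $e$, and with $\mathbb E[\|\mathbf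 g(x,f)-\nabla f(x)\|^{\mathfrak p}]\le\sigma_{\mathfrak l}^{\mathfrak p}$; different queries use fresh independent randomness. Let $\mathfrak A_T$ be the set of deterministic algorithms $\mathbf A_{0:T}=(\mathbf A_0,\dots,\mathbf A_T)$ with measurable maps $\mathbf A_t:(\mathbb R^d)^t\to\mathbb R^d$. Run on $F$ with the oracle $\mathbf g$, the algorithm starts at $x_1=\mathbf A_0$, and for $t=1,\dots,T$ it observes $g_t=\mathbf g(x_t,F)$ and sets $x_{t+1}=\mathbf A_t(g_1,\dots,g_t)$. For $\delta\in(0,1]$ define the high-probability minimax error, with values in $[0,+\infty]$, $$R_\star(\delta)=\sup_{\mathbf g\in\mathfrak G}\ \inf_{\mathbf A_{0:T}\in\mathfrak A_T}\ \sup_{F\in\mathfrak F_{D,G}}\ \inf\{\varepsilon\ge 0:\Pr[F(x_{T+1})-F_\star>\varepsilon]\le\delta\}.$$ Theorem. There is an absolute constant $c>0$ such that for all $D,G,\mathfrak p,\sigma_{\mathfrak s},\sigma_{\mathfrak l},T$ as above, all $d\ge d_{\mathrm{eff}}$ and all $\delta\in(0,1/10)$, $$R_\star(\delta)\ \ge\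 c\,\min\left\{GD,\ \sigma_{\mathfrak s}^{\frac2{\mathfrak p}-1}\sigma_{\mathfrak l}^{2-\frac2{\mathfrak p}}D,\ \frac{\left(\sigma_{\mathfrak s}^{\frac2{\mathfrak p}-1}\sigma_{\mathfrak l}^{2-\frac2{\mathfrak p}}+\sigma_{\mathfrak s}\ln^{1-\frac1{\mathfrak p}}\frac1{8\delta}\right)D}{T^{1-\frac1{\mathfrak p}}}\right\}.$$ -/

import Mathlib

open MeasureTheory ProbabilityTheory
open scoped ENNReal NNReal RealInnerProductSpace

namespace StochConvex

/-- `d`-dimensional Euclidean space, with its Borel σ-algebra. -/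
abbrev Euc (d : ℕ) : Type := EuclideanSpace ℝ (Fin d)

/-- The subdifferential of `f` at `x`. -/
def subdifferential {d : ℕ} (f : Euc d → ℝ) (x : Euc d) : Set (Euc d) :=
  {s | ∀ y, f x + ⟪s, y - x⟫ ≤ f y}

/-- The convex and `G`-Lipschitz functions on `ℝ^d`. -/
def convexLipschitz (d : ℕ) (G : ℝ) : Set (Euc d → ℝ) :=
  {f | ConvexOn ℝ Set.univ f ∧ ∀ x y, |f x - f y| ≤ G * ‖x - y‖}

/-- The set of global minimizers of `F`. -/
def argminSet {d : ℕ} (F : Euc d → ℝ) : Set (Euc d) :=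
  {x | ∀ y, F x ≤ F y}

/-- The problem class: convex `G`-Lipschitz objectives for which the infimum of the norms of the
minimizers is at most `D`. The infimum is taken in `[0, ∞]`, so it is `∞` (and the function is
excluded) when there is no minimizer. -/
def problemClass (d : ℕ) (D G : ℝ) : Set (convexLipschitz d G) :=
  {F | ⨅ x ∈ argminSet F.1, ‖x‖ₑ ≤ ENNReal.ofReal D}

/-- A stochastic first-order oracle with directional `p`-th moment noise level `σs` and `p`-th
moment noise level `σl`. Queried at `x` for the function `f`, it answers with a random vector of law
`law f x`; the draws at successive queries use fresh randomness. -/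
structure Oracle (d : ℕ) (G p σs σl : ℝ) where
  law : convexLipschitz d G → Kernel (Euc d) (Euc d)
  isMarkov : ∀ f, IsMarkovKernel (law f)
  integrable : ∀ f x, Integrable (fun z : Euc d => z) (law f x)
  mean_mem : ∀ f x, ∫ z, z ∂(law f x) ∈ subdifferential f.1 x
  directional_moment : ∀ f x (e : Euc d), ‖e‖ = 1 →
    ∫⁻ z, ENNReal.ofReal (|⟪e, z - ∫ w, w ∂(law f x)⟫| ^ p) ∂(law f x) ≤ ENNReal.ofReal (σs ^ p)
  norm_moment : ∀ f x,
    ∫⁻ z, ENNReal.ofReal (‖z - ∫ w, w ∂(law f x)‖ ^ p) ∂(law f x) ≤ ENNReal.ofReal (σl ^ p)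

/-- A deterministic algorithm with `T` iterations: measurable maps `A_0, …, A_T`, where `A_t` sends
the first `t` oracle answers to the next point `x_{t+1}`. -/
structure Algorithm (d T : ℕ) where
  step : ∀ t : ℕ, t ≤ T → (Fin t → Euc d) → Euc d
  measurable_step : ∀ (t : ℕ) (ht : t ≤ T), Measurable (step t ht)

/-- The joint law of the oracle answers `g_1, …, g_t` when `A` runs on `f`: given `g_1, …, g_t`,
the answer `g_{t+1}` has the law of the oracle at the point `x_{t+1} = A_t (g_1, …, g_t)`. -/
noncomputable def answersLaw {d T : ℕ} {G p σs σl : ℝ} (g : Oracle d G p σs σl)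
    (A : Algorithm d T) (f : convexLipschitz d G) : ∀ t : ℕ, t ≤ T → Measure (Fin t → Euc d)
  | 0, _ => Measure.dirac (fun i => Fin.elim0 i)
  | t + 1, ht =>
      ((answersLaw g A f t (Nat.le_of_succ_le ht)) ⊗ₘ
        ((g.law f).comap (A.step t (Nat.le_of_succ_le ht))
          (A.measurable_step t (Nat.le_of_succ_le ht)))).map
        (fun h => (Fin.snoc (α := fun _ => Euc d) h.1 h.2 : Fin (t + 1) → Euc d))

/-- The law of the output `x_{T+1} = A_T (g_1, …, g_T)`. -/
noncomputable def outputLaw {d T : ℕ} {G p σs σl : ℝ} (g : Oracle d G p σs σl)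
    (A : Algorithm d T) (f : convexLipschitz d G) : Measure (Euc d) :=
  (answersLaw g A f T le_rfl).map (A.step T le_rfl)

/-- `inf {ε ≥ 0 : Pr[F(x_{T+1}) - inf F > ε] ≤ δ}`, as an element of `[0, ∞]`. -/
noncomputable def errorQuantile {d T : ℕ} {G p σs σl : ℝ} (g : Oracle d G p σs σl)
    (A : Algorithm d T) (F : convexLipschitz d G) (δ : ℝ) : ℝ≥0∞ :=
  ⨅ (ε : ℝ≥0) (_ : outputLaw g A F {x | (ε : ℝ) < F.1 x - ⨅ y, F.1 y} ≤ ENNReal.ofReal δ),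
    (ε : ℝ≥0∞)

/-- The high-probability minimax error for convex problems, as an element of `[0, ∞]`. -/
noncomputable def minimaxError (d T : ℕ) (D G p σs σl δ : ℝ) : ℝ≥0∞ :=
  ⨆ g : Oracle d G p σs σl, ⨅ A : Algorithm d T, ⨆ F ∈ problemClass d D G, errorQuantile g A F δ

end StochConvex

/-! The bound comes from hiding signs. On a set `I` of k coordinates take the objectives x ↦ a ∑
|x_i - ε_i b| with unknown signs ε and b = D/√k, so that the minimizer supported on `I` has norm D.
Each sign that the output gets wrong costs at least ab = aD/√k. The oracle shows a coordinate of the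
subgradient with probability r, scaled by 1/r, and answers 0 there otherwise, so its mean is right.
The sign ε_i influences the answers only through coordinate i. Hence the sub-Markov part of the
oracle in which coordinate i is hidden is common to both values of ε_i, and after T adaptive queries
it still carries mass (1-r)^T. Le Cam's two point argument for each i, followed by an average over
ε, gives signs for which the expected number of errors is at least k(1-r)^T/2. Since that number
never exceeds k, this becomes a bound in probability (`RevealNoise.le_minimaxError`).

It remains to choose the parameters so that the noise is admissible (`RevealNoise`). For the
dimension term (`le_minimaxError_dimension`), k = ⌊d_eff⌋ and r = 1/(2T), so a constant fraction of
the signs is wrong. If k ≤ T at most one coordinate is shown per query, which gives the heavy-tailed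
rate; if k ≥ T the coordinates are shown independently and variances suffice. For the confidence
term (`le_minimaxError_confidence`), k = 1 and (1-r)^T = 8δ. The sum of the two rates is at most
twice the larger one.

An oracle must also answer measurably on every other function of the class, which calls for a
measurable selection of subgradients (`exists_measurable_subgradient`). -/

namespace StochConvex

/-! ### Measurable selection of subgradients -/

section Subgradient

open Filter Topology Set

/-- The one-sided directional derivative of `h` at `e` along `v`. -/
noncomputable def dirDeriv {E : Type*} [AddCommGroup E] [Module ℝ E] (h : E → ℝ) (e v : E) : ℝ :=
  derivWithin (fun t : ℝ => h (e + t • v)) (Ioi 0) 0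

/-- Subadditive and positively homogeneous functions. -/
structure Sublinear {E : Type*} [AddCommGroup E] [Module ℝ E] (h : E → ℝ) : Prop where
  add_le : ∀ v w, h (v + w) ≤ h v + h w
  smul_eq : ∀ (c : ℝ) (v : E), 0 < c → h (c • v) = c * h v

variable {E : Type*} [AddCommGroup E] [Module ℝ E] {h : E → ℝ}

theorem Sublinear.convexOn (hh : Sublinear h) : ConvexOn ℝ univ h := by
  refine convexOn_iff_forall_pos.2 ⟨convex_univ, fun x _ y _ a b ha hb _ => ?_⟩
  rw [smul_eq_mul, smul_eq_mul, ← hh.smul_eq a x ha, ← hh.smul_eq b y hb]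
  exact hh.add_le _ _

theorem Sublinear.map_zero (hh : Sublinear h) : h 0 = 0 := by
  have := hh.smul_eq 2 0 two_pos
  rw [smul_zero] at this
  linarith

theorem convexOn_comp_line (hh : ConvexOn ℝ univ h) (e v : E) :
    ConvexOn ℝ univ (fun t : ℝ => h (e + t • v)) := by
  refine ⟨convex_univ, fun x _ y _ a b ha hb hab => ?_⟩
  have := hh.2 (mem_univ (e + x • v)) (mem_univ (e + y • v)) ha hb hab
  convert this using 2
  have : e = a • e + b • e := by rw [← add_smul, hab, one_smul]
  nth_rewrite 1 [this]
  simp only [smul_add, smul_smul, add_smul, smul_eq_mul]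
  abel

theorem tendsto_dirDeriv (hh : ConvexOn ℝ univ h) (e v : E) :
    Tendsto (fun t : ℝ => t⁻¹ * (h (e + t • v) - h e)) (𝓝[>] 0) (𝓝 (dirDeriv h e v)) := by
  have h1 := (convexOn_comp_line hh e v).hasDerivWithinAt_rightDeriv_of_mem_interior
    (x := 0) (by simp)
  rw [hasDerivWithinAt_iff_tendsto_slope' (by simp)] at h1
  refine h1.congr fun t => ?_
  simp [slope_def_field, div_eq_inv_mul]

theorem dirDeriv_le (hh : ConvexOn ℝ univ h) (e v : E) : dirDeriv h e v ≤ h (e + v) - h e := by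
  have h1 := (convexOn_comp_line hh e v).rightDeriv_le_slope_of_mem_interior
    (x := 0) (y := 1) (by simp) (mem_univ _) one_pos
  simpa [slope_def_field, dirDeriv] using h1

theorem tendsto_const_mul_nhdsGT_zero {c : ℝ} (hc : 0 < c) :
    Tendsto (fun t : ℝ => c * t) (𝓝[>] 0) (𝓝[>] 0) := by
  refine tendsto_nhdsWithin_iff.2 ⟨?_, ?_⟩
  · have : Tendsto (fun t : ℝ => c * t) (𝓝 0) (𝓝 (c * 0)) :=
      (continuous_const.mul continuous_id).tendsto 0
    rw [mul_zero] at this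
    exact this.mono_left nhdsWithin_le_nhds
  · filter_upwards [self_mem_nhdsWithin] with t ht
    exact mul_pos hc ht

/-- Subadditivity is midpoint convexity between e + 2t•v and e + 2t•w, whose midpoint is e + t•(v +
w); homogeneity is the substitution t ↦ ct in the difference quotient. -/
theorem sublinear_dirDeriv (hh : ConvexOn ℝ univ h) (e : E) : Sublinear (dirDeriv h e) := by
  have hsc : ∀ (c : ℝ) (v : E), 0 < c → Tendsto
      (fun t : ℝ => (c * t)⁻¹ * (h (e + (c * t) • v) - h e)) (𝓝[>] 0) (𝓝 (dirDeriv h e v)) :=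
    fun c v hc => (tendsto_dirDeriv hh e v).comp (tendsto_const_mul_nhdsGT_zero hc)
  refine ⟨fun v w => ?_, fun c v hc => ?_⟩
  · refine le_of_tendsto_of_tendsto (tendsto_dirDeriv hh e (v + w))
      ((hsc 2 v two_pos).add (hsc 2 w two_pos)) ?_
    filter_upwards [self_mem_nhdsWithin] with t ht
    have ht : 0 < t := ht
    have h1 := hh.2 (mem_univ (e + (2 * t) • v)) (mem_univ (e + (2 * t) • w))
      (by norm_num : (0 : ℝ) ≤ 1 / 2) (by norm_num : (0 : ℝ) ≤ 1 / 2) (by norm_num)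
    have h2 : (1 / 2 : ℝ) • (e + (2 * t) • v) + (1 / 2 : ℝ) • (e + (2 * t) • w)
        = e + t • (v + w) := by
      module
    rw [h2, smul_eq_mul, smul_eq_mul] at h1
    have h3 : t⁻¹ * (h (e + t • (v + w)) - h e) ≤
        t⁻¹ * (1 / 2 * h (e + (2 * t) • v) + 1 / 2 * h (e + (2 * t) • w) - h e) :=
      mul_le_mul_of_nonneg_left (by linarith) (inv_pos.2 ht).le
    refine h3.trans_eq ?_
    field_simp
    ring
  · refine tendsto_nhds_unique (tendsto_dirDeriv hh e (c • v)) ?_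
    refine ((hsc c v hc).const_mul c).congr' ?_
    filter_upwards [self_mem_nhdsWithin] with t ht
    have ht : 0 < t := ht
    rw [smul_smul, mul_comm t c]
    field_simp

/-- A sublinear function is linear on the ray through e, so its derivative at e is linear in the
direction e: the increments to 2e and to 0 bound the two terms by h e and -h e. -/
theorem dirDeriv_self_add_neg_le (hh : Sublinear h) (e : E) :
    dirDeriv h e e + dirDeriv h e (-e) ≤ 0 := by
  have h1 := dirDeriv_le hh.convexOn e e
  have h2 : h (e + e) = 2 * h e := by rw [← two_smul ℝ e, hh.smul_eq 2 e two_pos]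
  have h3 := dirDeriv_le hh.convexOn e (-e)
  rw [add_neg_cancel, hh.map_zero] at h3
  linarith

theorem dirDeriv_le_self (hh : Sublinear h) (e v : E) : dirDeriv h e v ≤ h v := by
  have h1 := dirDeriv_le hh.convexOn e v
  have h2 := hh.add_le e v
  linarith

theorem measurable_dirDeriv {X : Type*} [MeasurableSpace X] {H : X → E → ℝ} {e : X → E}
    (hH : ∀ x, ConvexOn ℝ univ (H x)) (v : E) (hm : ∀ t : ℝ, Measurable fun x => H x (e x + t • v)) :
    Measurable fun x => dirDeriv (H x) (e x) v := by
  have hu : Tendsto (fun n : ℕ => 1 / ((n : ℝ) + 1)) atTop (𝓝[>] 0) :=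
    tendsto_nhdsWithin_iff.2 ⟨tendsto_one_div_add_atTop_nhds_zero_nat,
      Eventually.of_forall fun n => mem_Ioi.2 Nat.one_div_pos_of_nat⟩
  refine measurable_of_tendsto_metrizable (f := fun (n : ℕ) x =>
    (1 / ((n : ℝ) + 1))⁻¹ * (H x (e x + (1 / ((n : ℝ) + 1)) • v) - H x (e x))) (fun n => ?_) ?_
  · have h0 := hm 0
    simp only [zero_smul, add_zero] at h0
    exact ((hm _).sub h0).const_mul _
  · exact tendsto_pi_nhds.2 fun x => (tendsto_dirDeriv (hH x) (e x) v).comp hu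

/-- A convex function admits a sublinear minorant of its increments, depending measurably on the
base point, which is linear along any finite set of directions. -/
theorem exists_measurable_sublinear {X : Type*} [AddCommGroup X] [Module ℝ X] [MeasurableSpace X]
    {f : X → ℝ} (hf : ConvexOn ℝ univ f) (hm : ∀ v, Measurable fun x => f (x + v)) (l : List X) :
    ∃ H : X → X → ℝ, (∀ v, Measurable fun x => H x v) ∧ (∀ x, Sublinear (H x)) ∧
      (∀ x v, H x v ≤ f (x + v) - f x) ∧ ∀ x, ∀ w ∈ l, H x w + H x (-w) ≤ 0 := by
  induction l with
  | nil =>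
    exact ⟨fun x => dirDeriv f x, fun v => measurable_dirDeriv (H := fun _ => f) (e := id)
      (fun _ => hf) v fun t => hm _, fun x => sublinear_dirDeriv hf x,
      fun x v => dirDeriv_le hf x v, by simp⟩
  | cons e l ih =>
    obtain ⟨H, h1, h2, h3, h4⟩ := ih
    -- Differentiating at e makes the minorant linear along e. It also only decreases `H`, so
    -- linearity along the directions treated earlier survives.
    refine ⟨fun x => dirDeriv (H x) e, fun v => measurable_dirDeriv (e := fun _ => e)
      (fun x => (h2 x).convexOn) v fun t => h1 _, fun x => sublinear_dirDeriv (h2 x).convexOn e,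
      fun x v => (dirDeriv_le_self (h2 x) e v).trans (h3 x v), fun x w hw => ?_⟩
    rcases List.mem_cons.1 hw with rfl | hw
    · exact dirDeriv_self_add_neg_le (h2 x) w
    · have := dirDeriv_le_self (h2 x) e w
      have := dirDeriv_le_self (h2 x) e (-w)
      have := h4 x w hw
      linarith

end Subgradient

theorem Sublinear.sum_le {E ι : Type*} [AddCommGroup E] [Module ℝ E] {h : E → ℝ}
    (hh : Sublinear h) (s : Finset ι) (u : ι → E) : h (∑ i ∈ s, u i) ≤ ∑ i ∈ s, h (u i) := by
  classical
  induction s using Finset.induction_on with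
  | empty => simp [hh.map_zero]
  | insert i s hi ih =>
    rw [Finset.sum_insert hi, Finset.sum_insert hi]
    exact (hh.add_le _ _).trans (by linarith)

theorem Sublinear.smul_eq_of_add_neg_le {E : Type*} [AddCommGroup E] [Module ℝ E] {h : E → ℝ}
    (hh : Sublinear h) {w : E} (hw : h w + h (-w) ≤ 0) (c : ℝ) : h (c • w) = c * h w := by
  have h0 : h (-w) = -h w := by
    have := hh.add_le w (-w)
    rw [add_neg_cancel, hh.map_zero] at this
    linarith
  rcases lt_trichotomy c 0 with hc | rfl | hc
  · rw [← neg_smul_neg, hh.smul_eq _ _ (neg_pos.2 hc), h0]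
    ring
  · simp [hh.map_zero]
  · exact hh.smul_eq c w hc

/-- Expanding in the basis, subadditivity bounds h above by the linear form; the same bound at -v,
with 0 ≤ h v + h (-v), reverses it. -/
theorem Sublinear.eq_inner {d : ℕ} {h : Euc d → ℝ} (hh : Sublinear h)
    (hw : ∀ i, h (EuclideanSpace.single i 1) + h (-EuclideanSpace.single i 1) ≤ 0) (v : Euc d) :
    ⟪WithLp.toLp 2 fun i => h (EuclideanSpace.single i 1), v⟫ ≤ h v := by
  have key : ∀ v : Euc d,
      h v ≤ ⟪WithLp.toLp 2 fun i => h (EuclideanSpace.single i (1 : ℝ)), v⟫ := fun v => by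
    have hv : v = ∑ i, v i • EuclideanSpace.single i (1 : ℝ) := by
      ext j
      simp [Pi.single_apply]
    conv_lhs => rw [hv]
    refine (hh.sum_le _ _).trans_eq ?_
    simp only [hh.smul_eq_of_add_neg_le (hw _), PiLp.inner_apply]
    simp
  have h1 := key (-v)
  rw [inner_neg_right] at h1
  have h2 := hh.add_le v (-v)
  rw [add_neg_cancel, hh.map_zero] at h2
  linarith

/-- A convex Lipschitz function has a measurable selection of subgradients. -/
theorem exists_measurable_subgradient {d : ℕ} {G : ℝ} (f : convexLipschitz d G) :
    ∃ s : Euc d → Euc d, Measurable s ∧ ∀ x, s x ∈ subdifferential f.1 x := by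
  have hc : Continuous f.1 := by
    refine (LipschitzWith.of_dist_le_mul (K := G.toNNReal) fun x y => ?_).continuous
    rw [Real.dist_eq, dist_eq_norm]
    exact (f.2.2 x y).trans (mul_le_mul_of_nonneg_right (Real.le_coe_toNNReal G) (norm_nonneg _))
  obtain ⟨H, h1, h2, h3, h4⟩ := exists_measurable_sublinear f.2.1
    (fun v => (hc.comp (continuous_id.add continuous_const)).measurable)
    (List.ofFn fun i : Fin d => EuclideanSpace.single i (1 : ℝ))
  refine ⟨fun x => WithLp.toLp 2 fun i => H x (EuclideanSpace.single i 1), ?_, fun x y => ?_⟩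
  · exact (WithLp.measurable_toLp 2 _).comp (measurable_pi_lambda _ fun i => h1 _)
  · have h5 := (h2 x).eq_inner (fun i => h4 x _ (by simp)) (y - x)
    have h6 := h3 x (y - x)
    rw [add_sub_cancel] at h6
    linarith

/-! ### Laws of adaptive runs and the two point bound -/

section Runs

variable {d T : ℕ}

/-- The law of the answers when each one is drawn from the (sub-)Markov kernel `κ`. -/
noncomputable def runLaw (κ : Kernel (Euc d) (Euc d)) (A : Algorithm d T) :
    ∀ t : ℕ, t ≤ T → Measure (Fin t → Euc d)
  | 0, _ => Measure.dirac (fun i => Fin.elim0 i)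
  | t + 1, ht =>
      ((runLaw κ A t (Nat.le_of_succ_le ht)) ⊗ₘ
        (κ.comap (A.step t (Nat.le_of_succ_le ht))
          (A.measurable_step t (Nat.le_of_succ_le ht)))).map
        (fun h => (Fin.snoc (α := fun _ => Euc d) h.1 h.2 : Fin (t + 1) → Euc d))

theorem answersLaw_eq_runLaw {G p σs σl : ℝ} (g : Oracle d G p σs σl) (A : Algorithm d T)
    (f : convexLipschitz d G) : ∀ (t : ℕ) (ht : t ≤ T),
      answersLaw g A f t ht = runLaw (g.law f) A t ht
  | 0, _ => rfl
  | t + 1, ht => by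
    rw [answersLaw, runLaw, answersLaw_eq_runLaw g A f t]

theorem measurable_snoc (t : ℕ) : Measurable (fun h : (Fin t → Euc d) × Euc d =>
    (Fin.snoc (α := fun _ => Euc d) h.1 h.2 : Fin (t + 1) → Euc d)) := by
  refine measurable_pi_lambda _ fun i => ?_
  refine Fin.lastCases ?_ (fun j => ?_) i
  · simpa using measurable_snd
  · simpa [Function.comp_def] using (measurable_pi_apply j).comp measurable_fst

instance isFiniteMeasure_runLaw (κ : Kernel (Euc d) (Euc d)) [IsFiniteKernel κ]
    (A : Algorithm d T) : ∀ (t : ℕ) (ht : t ≤ T), IsFiniteMeasure (runLaw κ A t ht)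
  | 0, _ => by rw [runLaw]; infer_instance
  | t + 1, ht => by
    have := isFiniteMeasure_runLaw κ A t (Nat.le_of_succ_le ht)
    rw [runLaw]
    infer_instance

theorem compProd_mono {α β : Type*} [MeasurableSpace α] [MeasurableSpace β] {μ ν : Measure α}
    {κ η : Kernel α β} [SFinite μ] [SFinite ν] [IsSFiniteKernel κ] [IsSFiniteKernel η]
    (hμ : μ ≤ ν) (hκ : ∀ x, κ x ≤ η x) : μ ⊗ₘ κ ≤ ν ⊗ₘ η := by
  refine Measure.le_iff.2 fun s hs => ?_
  rw [Measure.compProd_apply hs, Measure.compProd_apply hs]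
  exact lintegral_mono' hμ fun x => hκ x _

theorem runLaw_mono {κ η : Kernel (Euc d) (Euc d)} [IsFiniteKernel κ] [IsFiniteKernel η]
    (hκ : ∀ x, κ x ≤ η x) (A : Algorithm d T) :
    ∀ (t : ℕ) (ht : t ≤ T), runLaw κ A t ht ≤ runLaw η A t ht
  | 0, _ => le_rfl
  | t + 1, ht => by
    rw [runLaw, runLaw]
    exact Measure.map_mono (compProd_mono (runLaw_mono hκ A t _) fun x => hκ _)
      (measurable_snoc t)

/-- The kernel loses the same mass at every query point, so adaptivity has no effect on the total.
-/
theorem runLaw_univ {κ : Kernel (Euc d) (Euc d)} [IsFiniteKernel κ] {q : ℝ≥0∞}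
    (hκ : ∀ x, κ x Set.univ = q) (A : Algorithm d T) :
    ∀ (t : ℕ) (ht : t ≤ T), runLaw κ A t ht Set.univ = q ^ t
  | 0, _ => by simp [runLaw]
  | t + 1, ht => by
    rw [runLaw, Measure.map_apply (measurable_snoc t) MeasurableSet.univ, Set.preimage_univ,
      Measure.compProd_apply MeasurableSet.univ]
    simp [hκ, runLaw_univ hκ A t, pow_succ, mul_comm]

/-- The law of the last point when each answer is drawn from the (sub-)Markov kernel `κ`. -/
noncomputable def runOutput (κ : Kernel (Euc d) (Euc d)) (A : Algorithm d T) : Measure (Euc d) :=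
  (runLaw κ A T le_rfl).map (A.step T le_rfl)

theorem runOutput_mono {κ η : Kernel (Euc d) (Euc d)} [IsFiniteKernel κ] [IsFiniteKernel η]
    (hκ : ∀ x, κ x ≤ η x) (A : Algorithm d T) : runOutput κ A ≤ runOutput η A :=
  Measure.map_mono (runLaw_mono hκ A T le_rfl) (A.measurable_step T le_rfl)

theorem runOutput_univ {κ : Kernel (Euc d) (Euc d)} [IsFiniteKernel κ] {q : ℝ≥0∞}
    (hκ : ∀ x, κ x Set.univ = q) (A : Algorithm d T) : runOutput κ A Set.univ = q ^ T := by
  rw [runOutput, Measure.map_apply (A.measurable_step T le_rfl) MeasurableSet.univ,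
    Set.preimage_univ, runLaw_univ hκ]

instance isProbabilityMeasure_runOutput (κ : Kernel (Euc d) (Euc d)) [IsMarkovKernel κ]
    (A : Algorithm d T) : IsProbabilityMeasure (runOutput κ A) :=
  ⟨by rw [runOutput_univ (q := 1) (fun x => measure_univ), one_pow]⟩

theorem outputLaw_eq_runOutput {G p σs σl : ℝ} (g : Oracle d G p σs σl) (A : Algorithm d T)
    (f : convexLipschitz d G) : outputLaw g A f = runOutput (g.law f) A := by
  rw [outputLaw, runOutput, answersLaw_eq_runLaw]

/-- Le Cam's two point bound, with a common part of the two kernels. -/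
theorem pow_le_runOutput_add {κ η₁ η₂ : Kernel (Euc d) (Euc d)} [IsFiniteKernel κ]
    [IsMarkovKernel η₁] [IsMarkovKernel η₂] {q : ℝ} (hq : 0 ≤ q)
    (hκ : ∀ x, κ x Set.univ = ENNReal.ofReal q) (h₁ : ∀ x, κ x ≤ η₁ x) (h₂ : ∀ x, κ x ≤ η₂ x)
    (A : Algorithm d T) {s₁ s₂ : Set (Euc d)} (hs : s₁ ∪ s₂ = Set.univ) :
    q ^ T ≤ (runOutput η₁ A).real s₁ + (runOutput η₂ A).real s₂ := by
  -- The output law of the common part has mass q ^ T, lies below both output laws, and is covered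
  -- by the two sets.
  have h : ENNReal.ofReal (q ^ T) ≤ runOutput η₁ A s₁ + runOutput η₂ A s₂ := by
    rw [ENNReal.ofReal_pow hq, ← runOutput_univ hκ A, ← hs]
    exact (measure_union_le _ _).trans
      (add_le_add (runOutput_mono h₁ A _) (runOutput_mono h₂ A _))
  rw [Measure.real, Measure.real, ← ENNReal.toReal_add (measure_ne_top _ _) (measure_ne_top _ _)]
  exact (ENNReal.ofReal_le_iff_le_toReal (ENNReal.add_ne_top.2
    ⟨measure_ne_top _ _, measure_ne_top _ _⟩)).1 h

end Runs

/-! ### Answers that reveal random coordinates -/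

section Reveal

variable {d : ℕ}

/-- The coordinates of `m` selected by `ω`, scaled up by `1 / r`. -/
noncomputable def reveal (r : ℝ) (ω : Fin d → Bool) (m : Euc d) : Euc d :=
  WithLp.toLp 2 fun i => if ω i then m i / r else 0

theorem measurable_reveal (r : ℝ) :
    Measurable fun z : Euc d × (Fin d → Bool) => reveal r z.2 z.1 := by
  refine (WithLp.measurable_toLp 2 _).comp (measurable_pi_lambda _ fun i => ?_)
  refine Measurable.ite ?_ ?_ measurable_const
  · have : Measurable fun z : Euc d × (Fin d → Bool) => z.2 i :=
      (measurable_pi_apply i).comp measurable_snd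
    exact this (measurableSet_singleton true)
  · fun_prop

/-- The kernel that answers at `x` with the coordinates of `m x` selected by a draw from `P`. -/
noncomputable def revealKernel (P : Measure (Fin d → Bool)) [IsFiniteMeasure P] (r : ℝ)
    (m : Euc d → Euc d) (hm : Measurable m) : Kernel (Euc d) (Euc d) :=
  (Kernel.deterministic m hm ×ₖ Kernel.const _ P).map fun z => reveal r z.2 z.1

theorem measurable_reveal_left (r : ℝ) (y : Euc d) :
    Measurable fun ω : Fin d → Bool => reveal r ω y :=
  (measurable_reveal r).comp (measurable_const.prodMk measurable_id)

theorem integral_map_reveal (P : Measure (Fin d → Bool)) (r : ℝ) {F : Type*} [NormedAddCommGroup F] [NormedSpace ℝ F] (y : Euc d)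
    {φ : Euc d → F} (hφ : StronglyMeasurable φ) :
    ∫ z, φ z ∂(P.map fun ω => reveal r ω y) = ∫ ω, φ (reveal r ω y) ∂P :=
  integral_map_of_stronglyMeasurable (measurable_reveal_left r y) hφ

variable (P : Measure (Fin d → Bool)) [IsFiniteMeasure P] (r : ℝ) {m : Euc d → Euc d}
  (hm : Measurable m)

instance : IsFiniteKernel (revealKernel P r m hm) := by
  unfold revealKernel; infer_instance

theorem revealKernel_apply (x : Euc d) :
    revealKernel P r m hm x = P.map fun ω => reveal r ω (m x) := by
  rw [revealKernel, Kernel.map_apply _ (measurable_reveal r), Kernel.prod_apply,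
    Kernel.deterministic_apply, Kernel.const_apply, Measure.dirac_prod,
    Measure.map_map (measurable_reveal r) measurable_prodMk_left]
  rfl

theorem isMarkovKernel_revealKernel [IsProbabilityMeasure P] :
    IsMarkovKernel (revealKernel P r m hm) := by
  refine ⟨fun x => ?_⟩
  rw [revealKernel_apply]
  exact Measure.isProbabilityMeasure_map (measurable_reveal_left r _).aemeasurable

/-- The part of `revealKernel` where coordinate `i` stays hidden does not depend on it. -/
theorem revealKernel_restrict_le {m' : Euc d → Euc d} (hm' : Measurable m') {i : Fin d}
    (h : ∀ x j, j ≠ i → m x j = m' x j) (x : Euc d) :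
    revealKernel (P.restrict {ω | ω i = false}) r m hm x ≤ revealKernel P r m' hm' x := by
  have hs : MeasurableSet {ω : Fin d → Bool | ω i = false} := Set.Finite.measurableSet
    (Set.toFinite _)
  rw [revealKernel_apply, revealKernel_apply]
  have h1 : (P.restrict {ω | ω i = false}).map (fun ω => reveal r ω (m x))
      = (P.restrict {ω | ω i = false}).map (fun ω => reveal r ω (m' x)) := by
    refine Measure.map_congr ?_
    filter_upwards [ae_restrict_mem hs] with ω hω
    have hω : ω i = false := hω
    ext j
    by_cases hj : j = i
    · subst hj
      simp [reveal, hω]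
    · simp [reveal, h x j hj]
  rw [h1]
  exact Measure.map_mono Measure.restrict_le_self (measurable_reveal_left r _)

theorem revealKernel_restrict_univ [IsProbabilityMeasure P] {i : Fin d}
    (hP : P.real {ω | ω i = true} = r) (x : Euc d) :
    revealKernel (P.restrict {ω | ω i = false}) r m hm x Set.univ = ENNReal.ofReal (1 - r) := by
  rw [revealKernel_apply, Measure.map_apply (measurable_reveal_left r _) MeasurableSet.univ,
    Set.preimage_univ, Measure.restrict_apply_univ, ← hP, ← probReal_compl_eq_one_sub
      (Set.Finite.measurableSet (Set.toFinite _)), ofReal_measureReal]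
  congr 1
  ext ω
  simp

theorem integrable_map_reveal {F : Type*} [NormedAddCommGroup F] (y : Euc d)
    {φ : Euc d → F} (hφ : StronglyMeasurable φ) :
    Integrable φ (P.map fun ω => reveal r ω y) :=
  (integrable_map_measure hφ.aestronglyMeasurable (measurable_reveal_left r y).aemeasurable).2
    Integrable.of_finite

theorem lintegral_map_reveal_le (y : Euc d) {φ : Euc d → ℝ} (hφ : Measurable φ)
    (h0 : ∀ z, 0 ≤ φ z) {B : ℝ} (hB : ∫ ω, φ (reveal r ω y) ∂P ≤ B) :
    ∫⁻ z, ENNReal.ofReal (φ z) ∂(P.map fun ω => reveal r ω y) ≤ ENNReal.ofReal B := by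
  rw [← ofReal_integral_eq_lintegral_ofReal (integrable_map_reveal P r y hφ.stronglyMeasurable)
    (Filter.Eventually.of_forall h0), integral_map_reveal P r y hφ.stronglyMeasurable]
  exact ENNReal.ofReal_le_ofReal hB

theorem integral_reveal {r : ℝ} (hr : r ≠ 0) {y : Euc d}
    (h : ∀ i, y i ≠ 0 → P.real {ω | ω i = true} = r) : ∫ ω, reveal r ω y ∂P = y := by
  ext i
  rw [eval_integral_piLp fun _ => Integrable.of_finite]
  have hs : MeasurableSet {ω : Fin d → Bool | ω i = true} := Set.Finite.measurableSet
    (Set.toFinite _)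
  have : (fun ω : Fin d → Bool => (reveal r ω y) i)
      = {ω : Fin d → Bool | ω i = true}.indicator fun _ => y i / r := by
    ext ω
    simp [reveal, Set.indicator]
  rw [this, integral_indicator_const _ hs]
  by_cases hy : y i = 0
  · simp [hy]
  · rw [h i hy, smul_eq_mul]
    field_simp

end Reveal

/-! ### The family of hard objectives -/

section HardFamily

variable {d : ℕ}

/-- The sign encoded by a Boolean. -/
def boolSign (β : Bool) : ℝ := if β then 1 else -1

/-- The separable objective `x ↦ a ∑_{i ∈ I} |x_i - b ε_i|` with signs `ε = v`. -/
noncomputable def hardFun (I : Finset (Fin d)) (a b : ℝ) (v : Fin d → Bool) (x : Euc d) : ℝ :=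
  a * ∑ i ∈ I, |x i - boolSign (v i) * b|

/-- A subgradient of `hardFun`. -/
noncomputable def hardGrad (I : Finset (Fin d)) (a b : ℝ) (v : Fin d → Bool) (x : Euc d) : Euc d :=
  WithLp.toLp 2 fun i => if i ∈ I then a * (SignType.sign (x i - boolSign (v i) * b) : ℝ) else 0

/-- A minimizer of `hardFun`. -/
noncomputable def hardMin (I : Finset (Fin d)) (b : ℝ) (v : Fin d → Bool) : Euc d :=
  WithLp.toLp 2 fun i => if i ∈ I then boolSign (v i) * b else 0

variable (I : Finset (Fin d)) {a b : ℝ} (v : Fin d → Bool)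

theorem boolSign_sq (β : Bool) : boolSign β ^ 2 = 1 := by
  cases β <;> simp [boolSign]

theorem abs_boolSign (β : Bool) : |boolSign β| = 1 := by
  cases β <;> simp [boolSign]

theorem boolSign_not (β : Bool) : boolSign (!β) = -boolSign β := by
  cases β <;> simp [boolSign]

theorem boolSign_injective : Function.Injective boolSign := by
  intro β γ
  cases β <;> cases γ <;> simp [boolSign] <;> norm_num

theorem sum_abs_le_sqrt_card_mul_norm (x : Euc d) : ∑ i ∈ I, |x i| ≤ √(I.card) * ‖x‖ := by
  have h1 : (∑ i ∈ I, |x i|) ^ 2 ≤ (√(I.card) * ‖x‖) ^ 2 := by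
    rw [mul_pow, Real.sq_sqrt (Nat.cast_nonneg _), EuclideanSpace.real_norm_sq_eq]
    refine sq_sum_le_card_mul_sum_sq.trans (mul_le_mul_of_nonneg_left ?_ (Nat.cast_nonneg _))
    simp only [sq_abs]
    exact Finset.sum_le_univ_sum_of_nonneg fun i => sq_nonneg _
  exact (le_abs_self _).trans (abs_le_of_sq_le_sq h1 (by positivity))

theorem hardFun_mem_convexLipschitz {G : ℝ} (ha : 0 ≤ a) (hG : a * √(I.card) ≤ G) :
    hardFun I a b v ∈ convexLipschitz d G := by
  refine ⟨⟨convex_univ, fun x _ y _ s t hs ht hst => ?_⟩, fun x y => ?_⟩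
  · simp only [hardFun, smul_eq_mul]
    rw [mul_left_comm, mul_left_comm t, ← mul_add, Finset.mul_sum I _ s, Finset.mul_sum I _ t,
      ← Finset.sum_add_distrib]
    refine mul_le_mul_of_nonneg_left (Finset.sum_le_sum fun i _ => ?_) ha
    have : (s • x + t • y) i - boolSign (v i) * b
        = s * (x i - boolSign (v i) * b) + t * (y i - boolSign (v i) * b) := by
      simp only [PiLp.add_apply, PiLp.smul_apply, smul_eq_mul]
      linear_combination (boolSign (v i) * b) * hst
    rw [this]
    refine (abs_add_le _ _).trans_eq ?_
    rw [abs_mul, abs_mul, abs_of_nonneg hs, abs_of_nonneg ht]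
  · rw [hardFun, hardFun, ← mul_sub, abs_mul, abs_of_nonneg ha, ← Finset.sum_sub_distrib]
    have h1 : |∑ i ∈ I, (|x i - boolSign (v i) * b| - |y i - boolSign (v i) * b|)|
        ≤ ∑ i ∈ I, |(x - y) i| := by
      refine (Finset.abs_sum_le_sum_abs _ _).trans (Finset.sum_le_sum fun i _ => ?_)
      refine (abs_abs_sub_abs_le _ _).trans_eq ?_
      simp
    calc a * _ ≤ a * (√(I.card) * ‖x - y‖) :=
          mul_le_mul_of_nonneg_left (h1.trans (sum_abs_le_sqrt_card_mul_norm I _)) ha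
      _ = a * √(I.card) * ‖x - y‖ := by ring
      _ ≤ G * ‖x - y‖ := mul_le_mul_of_nonneg_right hG (norm_nonneg _)

theorem measurable_hardGrad : Measurable (hardGrad I a b v) := by
  refine (WithLp.measurable_toLp 2 _).comp (measurable_pi_lambda _ fun i => ?_)
  by_cases hi : i ∈ I
  · simp only [hi, if_true]
    have h1 : ∀ y : ℝ, (SignType.sign y : ℝ) = if 0 < y then 1 else if y < 0 then -1 else 0 :=
      fun y => by
        rw [sign_apply]
        split_ifs <;> simp
    have h2 : Measurable fun y : ℝ => (SignType.sign y : ℝ) := by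
      simp only [h1]
      exact Measurable.ite measurableSet_Ioi measurable_const
        (Measurable.ite measurableSet_Iio measurable_const measurable_const)
    exact (h2.comp (by fun_prop : Measurable fun x : Euc d => x i - boolSign (v i) * b)).const_mul a
  · simp [hi]

theorem hardGrad_mem_subdifferential (ha : 0 ≤ a) (x : Euc d) :
    hardGrad I a b v x ∈ subdifferential (hardFun I a b v) x := by
  intro y
  have h1 : ⟪hardGrad I a b v x, y - x⟫ = a * ∑ i ∈ I,
      (SignType.sign (x i - boolSign (v i) * b) : ℝ) * (y i - x i) := by
    simp only [PiLp.inner_apply, hardGrad, Finset.mul_sum]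
    simp [mul_comm, mul_left_comm]
  rw [h1, hardFun, hardFun, ← mul_add, ← Finset.sum_add_distrib]
  refine mul_le_mul_of_nonneg_left (Finset.sum_le_sum fun i _ => ?_) ha
  set u := x i - boolSign (v i) * b
  have h2 : y i - x i = (y i - boolSign (v i) * b) - u := by ring
  rw [h2, mul_sub, sign_mul_self]
  set w := y i - boolSign (v i) * b
  rcases lt_trichotomy u 0 with hu | hu | hu
  · simpa [hu] using neg_le_abs w
  · simp [hu]
  · simpa [hu] using le_abs_self w

theorem abs_hardGrad_le (ha : 0 ≤ a) (x : Euc d) (i : Fin d) : |hardGrad I a b v x i| ≤ a := by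
  by_cases hi : i ∈ I
  · simp only [hardGrad, hi, if_true, abs_mul, abs_of_nonneg ha]
    refine mul_le_of_le_one_right ha ?_
    rcases SignType.trichotomy (SignType.sign (x i - boolSign (v i) * b)) with h | h | h <;> simp [h]
  · simpa [hardGrad, hi] using ha

theorem hardGrad_of_notMem (x : Euc d) {i : Fin d} (hi : i ∉ I) : hardGrad I a b v x i = 0 := by
  simp [hardGrad, hi]

theorem hardFun_nonneg (ha : 0 ≤ a) (x : Euc d) : 0 ≤ hardFun I a b v x :=
  mul_nonneg ha (Finset.sum_nonneg fun _ _ => abs_nonneg _)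

theorem hardFun_hardMin : hardFun I a b v (hardMin I b v) = 0 := by
  rw [hardFun, Finset.sum_eq_zero, mul_zero]
  intro i hi
  simp [hardMin, hi]

theorem norm_hardMin (hb : 0 ≤ b) : ‖hardMin I b v‖ = b * √(I.card) := by
  have : ∑ i, (hardMin I b v i) ^ 2 = b ^ 2 * I.card := by
    simp only [hardMin, ite_pow, mul_pow, boolSign_sq]
    simp [mul_comm]
  rw [EuclideanSpace.norm_eq]
  simp only [Real.norm_eq_abs, sq_abs]
  rw [this, Real.sqrt_mul (sq_nonneg b), Real.sqrt_sq hb]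

theorem iInf_hardFun (ha : 0 ≤ a) : ⨅ x, hardFun I a b v x = 0 :=
  le_antisymm ((ciInf_le ⟨0, by rintro _ ⟨x, rfl⟩; exact hardFun_nonneg I v ha x⟩
    (hardMin I b v)).trans_eq (hardFun_hardMin I v)) (le_ciInf (hardFun_nonneg I v ha))

theorem hardFun_mem_problemClass {D G : ℝ} (ha : 0 ≤ a) (hb : 0 ≤ b)
    (hG : a * √(I.card) ≤ G) (hD : b * √(I.card) ≤ D) :
    (⟨hardFun I a b v, hardFun_mem_convexLipschitz I v ha hG⟩ : convexLipschitz d G)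
      ∈ problemClass d D G := by
  have h1 : hardMin I b v ∈ argminSet (hardFun I a b v) := fun y => by
    rw [hardFun_hardMin]
    exact hardFun_nonneg I v ha y
  refine (iInf₂_le (f := fun (x : Euc d) (_ : x ∈ argminSet (hardFun I a b v)) => ‖x‖ₑ)
    (hardMin I b v) h1).trans ?_
  rw [← ofReal_norm, norm_hardMin I v hb]
  exact ENNReal.ofReal_le_ofReal hD

/-- An oracle sees the function and not the signs, so the answer must not depend on the choice of v.
The minimizer for w is a zero of the function for v, which forces v = w on `I`; signs outside `I`
play no role. -/
theorem hardGrad_eq_of_hardFun_eq (ha : 0 < a) (hb : 0 < b) {v w : Fin d → Bool}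
    (h : hardFun I a b v = hardFun I a b w) : hardGrad I a b v = hardGrad I a b w := by
  have h1 : hardFun I a b v (hardMin I b w) = 0 := by rw [h, hardFun_hardMin]
  rw [hardFun, mul_eq_zero, or_iff_right ha.ne',
    Finset.sum_eq_zero_iff_of_nonneg fun _ _ => abs_nonneg _] at h1
  have h2 : ∀ i ∈ I, v i = w i := fun i hi => by
    have h3 := h1 i hi
    simp only [hardMin, hi, if_true, abs_eq_zero, ← sub_mul, mul_eq_zero, or_iff_left hb.ne',
      sub_eq_zero] at h3
    exact (boolSign_injective h3).symm
  ext x i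
  by_cases hi : i ∈ I
  · simp [hardGrad, hi, h2 i hi]
  · simp [hardGrad, hi]

/-- The coordinates in `I` where `x` does not have the signs `v`. -/
noncomputable def wrongSigns (x : Euc d) : Finset (Fin d) := {i ∈ I | boolSign (v i) * x i ≤ 0}

/-- A coordinate with the wrong sign, or equal to zero, is at distance at least b from its target
±b. -/
theorem mul_card_wrongSigns_le (ha : 0 ≤ a) (x : Euc d) :
    a * b * (wrongSigns I v x).card ≤ hardFun I a b v x := by
  rw [hardFun, mul_assoc]
  refine mul_le_mul_of_nonneg_left ?_ ha
  have h1 : b * (wrongSigns I v x).card = ∑ i ∈ wrongSigns I v x, b := by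
    rw [Finset.sum_const, nsmul_eq_mul, mul_comm]
  rw [h1]
  refine (Finset.sum_le_sum fun i hi => ?_).trans (Finset.sum_le_sum_of_subset_of_nonneg
    (Finset.filter_subset _ _) fun _ _ _ => abs_nonneg _)
  have h2 := (Finset.mem_filter.1 hi).2
  have h3 : |x i - boolSign (v i) * b| = |b - boolSign (v i) * x i| := by
    have h4 : x i - boolSign (v i) * b = -boolSign (v i) * (b - boolSign (v i) * x i) := by
      linear_combination (-x i) * boolSign_sq (v i)
    rw [h4, abs_mul, abs_neg, abs_boolSign, one_mul]
  rw [h3]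
  exact (by linarith : b ≤ b - boolSign (v i) * x i).trans (le_abs_self _)

theorem hardGrad_update (x : Euc d) {i j : Fin d} (hj : j ≠ i) (β : Bool) :
    hardGrad I a b v x j = hardGrad I a b (Function.update v i β) x j := by
  simp [hardGrad, Function.update_of_ne hj]

end HardFamily

/-! ### The hard oracle and the hidden sign lower bound -/

/-- Each coordinate in `I` is revealed with probability `r` under `P`, and the noise of `reveal r`
satisfies the two moment bounds for all means supported on `I` with coordinates at most `a`. -/
structure RevealNoise {d : ℕ} (I : Finset (Fin d)) (P : Measure (Fin d → Bool))
    (r a p σs σl : ℝ) : Prop where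
  pos : 0 < r
  prob : ∀ i ∈ I, P.real {ω | ω i = true} = r
  directional : ∀ (m e : Euc d), (∀ i, |m i| ≤ a) → (∀ i ∉ I, m i = 0) → ‖e‖ = 1 →
    ∫ ω, |⟪e, reveal r ω m - m⟫| ^ p ∂P ≤ σs ^ p
  norm : ∀ m : Euc d, (∀ i, |m i| ≤ a) → (∀ i ∉ I, m i = 0) →
    ∫ ω, ‖reveal r ω m - m‖ ^ p ∂P ≤ σl ^ p

/-- The requirements on an oracle, for a single function. -/
structure IsAnswerLaw {d : ℕ} (p σs σl : ℝ) (f : Euc d → ℝ) (κ : Kernel (Euc d) (Euc d)) :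
    Prop where
  isMarkov : IsMarkovKernel κ
  integrable : ∀ x, Integrable (fun z : Euc d => z) (κ x)
  mean_mem : ∀ x, ∫ z, z ∂(κ x) ∈ subdifferential f x
  directional_moment : ∀ (x e : Euc d), ‖e‖ = 1 →
    ∫⁻ z, ENNReal.ofReal (|⟪e, z - ∫ w, w ∂(κ x)⟫| ^ p) ∂(κ x) ≤ ENNReal.ofReal (σs ^ p)
  norm_moment : ∀ x,
    ∫⁻ z, ENNReal.ofReal (‖z - ∫ w, w ∂(κ x)‖ ^ p) ∂(κ x) ≤ ENNReal.ofReal (σl ^ p)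

section

variable {d : ℕ} {p σs σl : ℝ}

theorem isAnswerLaw_deterministic (hp : 0 < p) {f : Euc d → ℝ} {s : Euc d → Euc d}
    (hs : Measurable s) (hf : ∀ x, s x ∈ subdifferential f x) :
    IsAnswerLaw p σs σl f (Kernel.deterministic s hs) where
  isMarkov := inferInstance
  integrable x := by
    rw [Kernel.deterministic_apply]
    exact integrable_dirac (by simp)
  mean_mem x := by
    rw [Kernel.deterministic_apply, integral_dirac]
    exact hf x
  directional_moment x e _ := by
    rw [Kernel.deterministic_apply, integral_dirac, lintegral_dirac]
    simp [Real.zero_rpow hp.ne']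
  norm_moment x := by
    rw [Kernel.deterministic_apply, integral_dirac, lintegral_dirac]
    simp [Real.zero_rpow hp.ne']

variable {I : Finset (Fin d)} {P : Measure (Fin d → Bool)} [IsProbabilityMeasure P] {r a b : ℝ}

theorem RevealNoise.isAnswerLaw (hP : RevealNoise I P r a p σs σl) (hp : 0 < p) (ha : 0 ≤ a)
    (v : Fin d → Bool) : IsAnswerLaw p σs σl (hardFun I a b v)
      (revealKernel P r (hardGrad I a b v) (measurable_hardGrad I v)) := by
  have hmean : ∀ x, ∫ z, z ∂(revealKernel P r (hardGrad I a b v) (measurable_hardGrad I v) x)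
      = hardGrad I a b v x := fun x => by
    rw [revealKernel_apply, integral_map_reveal P r _ (φ := fun z => z) stronglyMeasurable_id]
    refine integral_reveal P hP.pos.ne' fun i hi => hP.prob i ?_
    by_contra h
    exact hi (hardGrad_of_notMem I v x h)
  refine ⟨isMarkovKernel_revealKernel P r _, fun x => ?_, fun x => ?_, fun x e he => ?_,
    fun x => ?_⟩
  · rw [revealKernel_apply]
    exact integrable_map_reveal P r _ stronglyMeasurable_id
  · rw [hmean]
    exact hardGrad_mem_subdifferential I v ha x
  · rw [hmean, revealKernel_apply]
    refine lintegral_map_reveal_le P r _ ?_ (fun z => by positivity) ?_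
    · exact (continuous_abs.comp (continuous_const.inner (continuous_id.sub continuous_const))
        |>.rpow_const fun _ => Or.inr hp.le).measurable
    · exact hP.directional _ e (abs_hardGrad_le I v ha x) (fun i => hardGrad_of_notMem I v x) he
  · rw [hmean, revealKernel_apply]
    refine lintegral_map_reveal_le P r _ ?_ (fun z => by positivity) ?_
    · exact ((continuous_id.sub continuous_const).norm.rpow_const
        fun _ => Or.inr hp.le).measurable
    · exact hP.norm _ (abs_hardGrad_le I v ha x) fun i => hardGrad_of_notMem I v x

theorem RevealNoise.exists_oracle {G : ℝ} (hP : RevealNoise I P r a p σs σl) (hp : 0 < p)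
    (ha : 0 < a) (hb : 0 < b) : ∃ g : Oracle d G p σs σl, ∀ (f : convexLipschitz d G)
      (v : Fin d → Bool), f.1 = hardFun I a b v →
      g.law f = revealKernel P r (hardGrad I a b v) (measurable_hardGrad I v) := by
  have h : ∀ f : convexLipschitz d G, ∃ κ, IsAnswerLaw p σs σl f.1 κ ∧ ∀ v : Fin d → Bool,
      f.1 = hardFun I a b v →
      κ = revealKernel P r (hardGrad I a b v) (measurable_hardGrad I v) := by
    intro f
    by_cases hf : ∃ v, f.1 = hardFun I a b v
    · obtain ⟨v, hv⟩ := hf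
      refine ⟨revealKernel P r (hardGrad I a b v) (measurable_hardGrad I v),
        hv ▸ hP.isAnswerLaw hp ha.le v, fun w hw => ?_⟩
      have := hardGrad_eq_of_hardFun_eq I ha hb (hv.symm.trans hw)
      congr 1
    -- Functions outside the hard family are answered without noise.
    · obtain ⟨s, hs, hs'⟩ := exists_measurable_subgradient f
      exact ⟨_, isAnswerLaw_deterministic hp hs hs', fun v hv => absurd ⟨v, hv⟩ hf⟩
  choose law h1 h2 using h
  exact ⟨⟨law, fun f => (h1 f).isMarkov, fun f => (h1 f).integrable, fun f => (h1 f).mean_mem,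
    fun f => (h1 f).directional_moment, fun f => (h1 f).norm_moment⟩, h2⟩

/-- On average over the signs `v`, every coordinate that is revealed with probability `r` per query
gets the wrong sign with probability at least `(1 - r) ^ T / 2`. -/
theorem RevealNoise.sum_wrongSign_ge (hP : RevealNoise I P r a p σs σl) {T : ℕ}
    (A : Algorithm d T) {i : Fin d} (hi : i ∈ I) :
    (2 ^ d * ((1 - r) ^ T / 2) : ℝ) ≤ ∑ v : Fin d → Bool,
      (runOutput (revealKernel P r (hardGrad I a b v) (measurable_hardGrad I v)) A).real
        {x | boolSign (v i) * x i ≤ 0} := by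
  set φ : (Fin d → Bool) → ℝ := fun v =>
    (runOutput (revealKernel P r (hardGrad I a b v) (measurable_hardGrad I v)) A).real
        {x | boolSign (v i) * x i ≤ 0} with hφ
  have hr1 : r ≤ 1 := by
    rw [← hP.prob i hi]
    exact measureReal_le_one
  have := fun v => isMarkovKernel_revealKernel P r (measurable_hardGrad (a := a) (b := b) I v)
  have hflip : Function.Involutive fun v : Fin d → Bool => Function.update v i (!v i) := by
    intro v
    ext j
    by_cases hj : j = i
    · subst hj
      simp
    · simp [hj]
  -- Pair v with its flip at i: with coordinate i hidden the two oracles agree, and every output has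
  -- the wrong sign for at least one of them. Zero counts as wrong for both.
  have h1 : ∀ v : Fin d → Bool, (1 - r) ^ T ≤ φ v + φ (Function.update v i (!v i)) := by
    intro v
    refine pow_le_runOutput_add (sub_nonneg.2 hr1)
      (revealKernel_restrict_univ P r (measurable_hardGrad (a := a) (b := b) I v) (hP.prob i hi))
      (revealKernel_restrict_le P r _ _ fun x j _ => rfl)
      (revealKernel_restrict_le P r _ _ fun x j hj => hardGrad_update I v x hj _) A ?_
    ext x
    simp only [Function.update_self, boolSign_not, Set.mem_union, Set.mem_ofPred_eq, Set.mem_univ,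
      iff_true]
    rcases le_total (boolSign (v i) * x i) 0 with h | h
    · exact Or.inl h
    · exact Or.inr (by linarith)
  have h2 : ∑ v, φ (Function.update v i (!v i)) = ∑ v, φ v :=
    Equiv.sum_comp (hflip.toPerm _) φ
  have h3 : ∑ _v : Fin d → Bool, (1 - r) ^ T ≤ ∑ v, (φ v + φ (Function.update v i (!v i))) :=
    Finset.sum_le_sum fun v _ => h1 v
  rw [Finset.sum_add_distrib, h2] at h3
  simp only [Finset.sum_const, Finset.card_univ, Fintype.card_fun, Fintype.card_bool,
    Fintype.card_fin, nsmul_eq_mul, Nat.cast_pow, Nat.cast_ofNat] at h3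
  linarith

/-- Exchanging the sums over signs and coordinates, some v is at least as bad as the average for all
of `I` together. -/
theorem RevealNoise.exists_sum_wrongSign_ge (hP : RevealNoise I P r a p σs σl) {T : ℕ} (b : ℝ)
    (A : Algorithm d T) : ∃ v : Fin d → Bool, I.card * ((1 - r) ^ T / 2) ≤ ∑ i ∈ I,
      (runOutput (revealKernel P r (hardGrad I a b v) (measurable_hardGrad I v)) A).real
        {x | boolSign (v i) * x i ≤ 0} := by
  have h := Finset.sum_le_sum fun i hi => hP.sum_wrongSign_ge (b := b) A hi
  rw [Finset.sum_comm] at h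
  obtain ⟨v, -, hv⟩ := Finset.exists_le_of_sum_le (s := (Finset.univ : Finset (Fin d → Bool)))
    (f := fun _ => I.card * ((1 - r) ^ T / 2)) Finset.univ_nonempty (le_trans (by simp; linarith) h)
  exact ⟨v, hv⟩

/-- A reverse Markov inequality: the left side is the expected number of wrong signs, and this
number is at most n, or at most |I| on the event that it exceeds n. -/
theorem sum_wrongSign_le (μ : Measure (Euc d)) [IsProbabilityMeasure μ] (I : Finset (Fin d))
    (v : Fin d → Bool) (n : ℕ) : ∑ i ∈ I, μ.real {x | boolSign (v i) * x i ≤ 0} ≤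
      n + I.card * μ.real {x | n < (wrongSigns I v x).card} := by
  classical
  have hm : ∀ i, MeasurableSet {x : Euc d | boolSign (v i) * x i ≤ 0} := fun i =>
    measurableSet_le (by fun_prop) measurable_const
  have hc : ∀ x, ∑ i ∈ I, {x : Euc d | boolSign (v i) * x i ≤ 0}.indicator (fun _ => (1 : ℝ)) x
      = (wrongSigns I v x).card := fun x => by
    simp [wrongSigns, Set.indicator]
  have hS : MeasurableSet {x | n < (wrongSigns I v x).card} := by
    have : Measurable fun x => ((wrongSigns I v x).card : ℝ) := by
      simp only [← hc]
      exact Finset.measurable_sum _ fun i _ => measurable_const.indicator (hm i)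
    simpa using measurableSet_lt (measurable_const (a := (n : ℝ))) this
  have hi : ∀ s : Set (Euc d), MeasurableSet s →
      Integrable (s.indicator fun _ => (1 : ℝ)) μ := fun s hs =>
    (integrable_const 1).indicator hs
  calc ∑ i ∈ I, μ.real {x | boolSign (v i) * x i ≤ 0}
      = ∑ i ∈ I, ∫ x, {x : Euc d | boolSign (v i) * x i ≤ 0}.indicator (fun _ => (1 : ℝ)) x ∂μ :=
        Finset.sum_congr rfl fun i _ => by
          rw [integral_indicator_const _ (hm i), smul_eq_mul, mul_one]
    _ = ∫ x, ∑ i ∈ I, {x : Euc d | boolSign (v i) * x i ≤ 0}.indicator (fun _ => (1 : ℝ)) x ∂μ :=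
        (integral_finsetSum _ fun i _ => hi _ (hm i)).symm
    _ ≤ ∫ x, (n + I.card * {x | n < (wrongSigns I v x).card}.indicator (fun _ => (1 : ℝ)) x) ∂μ := by
        refine integral_mono (integrable_finsetSum _ fun i _ => hi _ (hm i))
          ((integrable_const _).add ((hi _ hS).const_mul _)) fun x => ?_
        simp only [hc]
        by_cases hx : n < (wrongSigns I v x).card
        · rw [Set.indicator_of_mem (by exact hx)]
          have : ((wrongSigns I v x).card : ℝ) ≤ I.card :=
            Nat.cast_le.2 (Finset.card_le_card (Finset.filter_subset _ _))
          have : (0 : ℝ) ≤ n := Nat.cast_nonneg n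
          linarith
        · rw [Set.indicator_of_notMem (by exact hx), mul_zero, add_zero]
          exact Nat.cast_le.2 (not_lt.1 hx)
    _ = _ := by
        rw [integral_add (integrable_const _) ((hi _ hS).const_mul _), integral_const_mul,
          integral_indicator_const _ hS]
        simp

/-- The lower bound on the minimax error obtained from hidden coordinates. -/
theorem RevealNoise.le_minimaxError {T : ℕ} {D G δ : ℝ} (hP : RevealNoise I P r a p σs σl)
    (hp : 0 < p) (hI : I.Nonempty) (ha : 0 < a) (hD : 0 < D) (hG : a * √(I.card) ≤ G)
    (hδ : 0 ≤ δ) (n : ℕ) (hn : n + I.card * δ < I.card * ((1 - r) ^ T / 2)) :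
    ENNReal.ofReal (a * D / √(I.card) * (n + 1)) ≤ minimaxError d T D G p σs σl δ := by
  have hk : 0 < √(I.card) := Real.sqrt_pos.2 (Nat.cast_pos.2 hI.card_pos)
  set b := D / √(I.card) with hb'
  have hb : 0 < b := div_pos hD hk
  have hbD : b * √(I.card) = D := div_mul_cancel₀ _ hk.ne'
  obtain ⟨g, hg⟩ := hP.exists_oracle (G := G) hp ha hb
  refine le_iSup_of_le g (le_iInf fun A => ?_)
  obtain ⟨v, hv⟩ := hP.exists_sum_wrongSign_ge b A
  refine le_iSup₂_of_le _ (hardFun_mem_problemClass I v ha.le hb.le hG hbD.le) ?_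
  refine le_iInf₂ fun ε hε => ?_
  rw [outputLaw_eq_runOutput, hg _ v rfl] at hε
  have := isMarkovKernel_revealKernel P r (measurable_hardGrad (a := a) (b := b) I v)
  set μ := runOutput (revealKernel P r (hardGrad I a b v) (measurable_hardGrad I v)) A
  rw [ENNReal.ofReal_le_coe]
  -- If ε were below ab(n + 1), more than n wrong signs would force an error above ε, hence have
  -- probability at most δ. The expected number of wrong signs would then be at most n + |I|δ,
  -- against `hn`.
  by_contra! hlt
  have h1 : μ {x | n < (wrongSigns I v x).card} ≤ ENNReal.ofReal δ := by
    refine (measure_mono fun x hx => ?_).trans hε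
    have hx : n + 1 ≤ (wrongSigns I v x).card := hx
    have hx' : (n : ℝ) + 1 ≤ (wrongSigns I v x).card := by exact_mod_cast hx
    change (ε : ℝ) < hardFun I a b v x - ⨅ y, hardFun I a b v y
    rw [iInf_hardFun I v ha.le, sub_zero]
    refine lt_of_lt_of_le ?_ (mul_card_wrongSigns_le I v ha.le x)
    refine lt_of_lt_of_le hlt ?_
    rw [mul_div_assoc]
    exact mul_le_mul_of_nonneg_left hx' (mul_pos ha hb).le
  have h2 : μ.real {x | n < (wrongSigns I v x).card} ≤ δ :=
    ENNReal.toReal_le_of_le_ofReal hδ h1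
  have h3 := sum_wrongSign_le μ I v n
  have h4 : (I.card : ℝ) * μ.real {x | n < (wrongSigns I v x).card} ≤ I.card * δ :=
    mul_le_mul_of_nonneg_left h2 (Nat.cast_nonneg _)
  linarith

end

/-! ### From second moments to p-th moments -/

section TangentBound

/-- Concavity of `t ↦ t ^ (p / 2)` in tangent form. -/
theorem abs_rpow_le_tangent {p s : ℝ} (hp : 0 ≤ p) (hp2 : p ≤ 2) (hs : 0 < s) (x : ℝ) :
    |x| ^ p ≤ s ^ p * (1 + p / 2 * (x ^ 2 / s ^ 2 - 1)) := by
  have h0 : 0 ≤ x ^ 2 / s ^ 2 := by positivity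
  have h1 := rpow_one_add_le_one_add_mul_self (s := x ^ 2 / s ^ 2 - 1) (by linarith)
    (p := p / 2) (by linarith) (by linarith)
  have h2 : (1 + (x ^ 2 / s ^ 2 - 1)) ^ (p / 2) = |x| ^ p / s ^ p := by
    rw [add_sub_cancel, ← div_pow, ← sq_abs, ← Real.rpow_natCast, ← Real.rpow_mul (abs_nonneg _),
      abs_div, abs_of_pos hs, Nat.cast_ofNat, mul_div_cancel₀ p two_ne_zero,
      Real.div_rpow (abs_nonneg _) hs.le]
  rw [h2, div_le_iff₀ (Real.rpow_pos_of_pos hs p)] at h1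
  linarith

/-- The tangent is taken at s = |I|^(-1/2), the common size of the entries of a flat unit vector,
which is the extremal case. -/
theorem sum_abs_rpow_le {ι : Type*} {p : ℝ} (hp : 0 ≤ p) (hp2 : p ≤ 2) {I : Finset ι}
    (hI : I.Nonempty) {x : ι → ℝ} (hx : ∑ i ∈ I, x i ^ 2 ≤ 1) :
    ∑ i ∈ I, |x i| ^ p ≤ (I.card : ℝ) ^ (1 - p / 2) := by
  have hk : (0 : ℝ) < I.card := Nat.cast_pos.2 hI.card_pos
  set s : ℝ := (I.card : ℝ) ^ (-(1 / 2) : ℝ) with hs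
  have hs0 : 0 < s := Real.rpow_pos_of_pos hk _
  have hs2 : s ^ 2 = (I.card : ℝ)⁻¹ := by
    rw [hs, ← Real.rpow_natCast, ← Real.rpow_mul hk.le, ← Real.rpow_neg_one]
    norm_num
  have hsp : (I.card : ℝ) ^ (1 - p / 2) = I.card * s ^ p := by
    rw [hs, ← Real.rpow_mul hk.le]
    nth_rewrite 2 [← Real.rpow_one (I.card : ℝ)]
    rw [← Real.rpow_add hk]
    congr 1
    ring
  refine (Finset.sum_le_sum fun i _ => abs_rpow_le_tangent hp hp2 hs0 (x i)).trans ?_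
  rw [← Finset.mul_sum, Finset.sum_add_distrib, ← Finset.mul_sum, Finset.sum_sub_distrib,
    ← Finset.sum_div, hs2, div_inv_eq_mul, hsp, mul_comm]
  refine mul_le_mul_of_nonneg_right ?_ (Real.rpow_pos_of_pos hs0 p).le
  simp only [Finset.sum_const, nsmul_eq_mul, mul_one]
  have : p / 2 * ((∑ i ∈ I, x i ^ 2) * I.card - I.card) ≤ 0 :=
    mul_nonpos_of_nonneg_of_nonpos (by linarith) (by nlinarith)
  linarith

theorem integral_abs_rpow_le {Ω : Type*} [MeasurableSpace Ω] [Finite Ω]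
    [MeasurableSingletonClass Ω] {P : Measure Ω} [IsProbabilityMeasure P] {p s : ℝ} (hp : 0 ≤ p)
    (hp2 : p ≤ 2) (hs : 0 < s) {X : Ω → ℝ} (hX : ∫ ω, X ω ^ 2 ∂P ≤ s ^ 2) :
    ∫ ω, |X ω| ^ p ∂P ≤ s ^ p := by
  refine (integral_mono Integrable.of_finite Integrable.of_finite
    fun ω => abs_rpow_le_tangent hp hp2 hs (X ω)).trans ?_
  rw [integral_const_mul, integral_add Integrable.of_finite Integrable.of_finite,
    integral_const_mul, integral_sub Integrable.of_finite Integrable.of_finite,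
    integral_div, integral_const, probReal_univ, one_smul]
  refine mul_le_of_le_one_right (Real.rpow_pos_of_pos hs p).le ?_
  have : (∫ ω, X ω ^ 2 ∂P) / s ^ 2 ≤ 1 := (div_le_one (by positivity)).2 hX
  have : p / 2 * ((∫ ω, X ω ^ 2 ∂P) / s ^ 2 - 1) ≤ 0 :=
    mul_nonpos_of_nonneg_of_nonpos (by linarith) (by linarith)
  linarith

end TangentBound

theorem sq_norm_le_of_abs_le {d : ℕ} {I : Finset (Fin d)} {m : Euc d} {a : ℝ}
    (hm : ∀ i, |m i| ≤ a) (hI : ∀ i ∉ I, m i = 0) : ‖m‖ ^ 2 ≤ I.card * a ^ 2 := by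
  rw [EuclideanSpace.real_norm_sq_eq, ← Finset.sum_subset (Finset.subset_univ I)
    fun i _ hi => by rw [hI i hi]; norm_num]
  refine (Finset.sum_le_card_nsmul I _ (a ^ 2) fun i _ => ?_).trans_eq (nsmul_eq_mul _ _)
  exact sq_le_sq' (by linarith [neg_abs_le (m i), hm i]) ((le_abs_self _).trans (hm i))

/-! ### Noise with independent coordinates -/

section Independent

/-- The Bernoulli distribution on `Bool`. -/
noncomputable def coin (r : ℝ) : Measure Bool :=
  ENNReal.ofReal r • Measure.dirac true + ENNReal.ofReal (1 - r) • Measure.dirac false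

variable {d : ℕ} {r : ℝ}

theorem isProbabilityMeasure_coin (hr : 0 ≤ r) (hr1 : r ≤ 1) : IsProbabilityMeasure (coin r) := by
  refine ⟨?_⟩
  simp only [coin, Measure.add_apply, Measure.smul_apply, measure_univ, smul_eq_mul, mul_one]
  rw [← ENNReal.ofReal_add hr (sub_nonneg.2 hr1)]
  simp

theorem integral_coin (hr : 0 ≤ r) (hr1 : r ≤ 1) (φ : Bool → ℝ) :
    ∫ β, φ β ∂(coin r) = r * φ true + (1 - r) * φ false := by
  rw [coin, integral_add_measure (Integrable.of_finite.smul_measure ENNReal.ofReal_ne_top)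
    (Integrable.of_finite.smul_measure ENNReal.ofReal_ne_top), integral_smul_measure,
    integral_smul_measure, integral_dirac, integral_dirac, ENNReal.toReal_ofReal hr,
    ENNReal.toReal_ofReal (sub_nonneg.2 hr1), smul_eq_mul, smul_eq_mul]

/-- The relative error of a coordinate that is revealed with probability `r`. -/
noncomputable def coinNoise (r : ℝ) (β : Bool) : ℝ := (if β then 1 / r else 0) - 1

theorem integral_coinNoise_sq_le (hr : 0 < r) (hr1 : r ≤ 1) :
    ∫ β, coinNoise r β ^ 2 ∂(coin r) ≤ 1 / r := by
  rw [integral_coin hr.le hr1, le_div_iff₀ hr]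
  simp only [coinNoise, if_true, Bool.false_eq_true, if_false]
  have : (r * (1 / r - 1) ^ 2 + (1 - r) * (0 - 1) ^ 2) * r = 1 - r := by
    field_simp
    ring
  linarith

theorem reveal_sub_apply (ω : Fin d → Bool) (m : Euc d) (i : Fin d) :
    (reveal r ω m - m) i = m i * coinNoise r (ω i) := by
  simp only [reveal, coinNoise, PiLp.sub_apply]
  split_ifs <;> ring

theorem integral_pi_coin (hr : 0 ≤ r) (hr1 : r ≤ 1) (i : Fin d) (φ : Bool → ℝ) :
    ∫ ω : Fin d → Bool, φ (ω i) ∂(Measure.pi fun _ => coin r) = ∫ β, φ β ∂(coin r) := by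
  have := isProbabilityMeasure_coin hr hr1
  have h := measurePreserving_eval (fun _ : Fin d => coin r) i
  have h' := integral_map_of_stronglyMeasurable (μ := Measure.pi fun _ : Fin d => coin r) h.measurable
    (measurable_of_finite φ).stronglyMeasurable
  rw [h.map_eq] at h'
  exact h'.symm

/-- Variances of independent coordinates add, and each is at most a²/r ≤ σs² before weighting by
e_i². So a unit direction has second moment at most σs², and the whole vector at most |I| σs² ≤ σl².
-/
theorem revealNoise_pi_coin {I : Finset (Fin d)} {a p σs σl : ℝ} (hr : 0 < r) (hr1 : r ≤ 1)
    (hp : 0 ≤ p) (hp2 : p ≤ 2) (hs : 0 < σs) (hl : 0 < σl) (har : a ^ 2 ≤ r * σs ^ 2)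
    (hσ : I.card * σs ^ 2 ≤ σl ^ 2) :
    RevealNoise I (Measure.pi fun _ : Fin d => coin r) r a p σs σl := by
  have := isProbabilityMeasure_coin hr.le hr1
  have hprob : ∀ i : Fin d, (Measure.pi fun _ : Fin d => coin r).real {ω | ω i = true} = r := by
    intro i
    have h := integral_pi_coin hr.le hr1 i fun β => if β then (1 : ℝ) else 0
    rw [integral_coin hr.le hr1] at h
    have hm : MeasurableSet {ω : Fin d → Bool | ω i = true} :=
      Set.Finite.measurableSet (Set.toFinite _)
    rw [← mul_one (Measure.real _ _), ← smul_eq_mul, ← integral_indicator_const _ hm]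
    simpa [Set.indicator] using h
  refine ⟨hr, fun i _ => hprob i, fun m e hm hmI he => integral_abs_rpow_le hp hp2 hs ?_,
    fun m hm hmI => ?_⟩
  · have hX : (fun ω : Fin d → Bool => ⟪e, reveal r ω m - m⟫)
        = ∑ i, fun ω : Fin d → Bool => e i * m i * coinNoise r (ω i) := by
      ext ω
      rw [Finset.sum_apply]
      simp only [PiLp.inner_apply, reveal_sub_apply]
      exact Finset.sum_congr rfl fun i _ => by simp; ring
    have hmean : ∫ ω, ⟪e, reveal r ω m - m⟫ ∂(Measure.pi fun _ : Fin d => coin r) = 0 := by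
      rw [integral_inner Integrable.of_finite, integral_sub Integrable.of_finite
        Integrable.of_finite, integral_reveal _ hr.ne' fun i _ => hprob i]
      simp
    have hvar := variance_of_integral_eq_zero (μ := Measure.pi fun _ : Fin d => coin r)
      (X := fun ω => ⟪e, reveal r ω m - m⟫) (measurable_of_finite _).aemeasurable hmean
    rw [← hvar, hX, variance_sum_pi (X := fun i β => e i * m i * coinNoise r β)
      fun i => MemLp.of_discrete]
    have h1 : ∀ i : Fin d, Var[fun β => e i * m i * coinNoise r β; coin r] ≤ e i ^ 2 * σs ^ 2 := by
      intro i
      refine (variance_le_expectation_sq (measurable_of_finite _).aestronglyMeasurable).trans ?_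
      simp only [Pi.pow_apply, mul_pow]
      rw [integral_const_mul, mul_assoc]
      refine mul_le_mul_of_nonneg_left ?_ (sq_nonneg _)
      have h2 : m i ^ 2 ≤ a ^ 2 := sq_le_sq' (by linarith [neg_abs_le (m i), hm i])
        ((le_abs_self _).trans (hm i))
      calc m i ^ 2 * ∫ β, coinNoise r β ^ 2 ∂(coin r) ≤ r * σs ^ 2 * (1 / r) :=
            mul_le_mul (h2.trans har) (integral_coinNoise_sq_le hr hr1)
              (integral_nonneg fun β => sq_nonneg _) (by positivity)
        _ = σs ^ 2 := by field_simp
    refine (Finset.sum_le_sum fun i _ => h1 i).trans_eq ?_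
    rw [← Finset.sum_mul, ← EuclideanSpace.real_norm_sq_eq, he, one_pow, one_mul]
  · have h0 := integral_abs_rpow_le (P := Measure.pi fun _ : Fin d => coin r)
      (X := fun ω => ‖reveal r ω m - m‖) hp hp2 hl ?_
    · simpa only [abs_norm] using h0
    simp only [EuclideanSpace.real_norm_sq_eq, reveal_sub_apply, mul_pow]
    rw [integral_finsetSum _ fun _ _ => Integrable.of_finite]
    have h1 : ∀ i : Fin d, ∫ ω : Fin d → Bool, m i ^ 2 * coinNoise r (ω i) ^ 2
        ∂(Measure.pi fun _ => coin r) ≤ m i ^ 2 * (1 / r) := by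
      intro i
      rw [integral_const_mul, integral_pi_coin hr.le hr1 i fun β => coinNoise r β ^ 2]
      exact mul_le_mul_of_nonneg_left (integral_coinNoise_sq_le hr hr1) (sq_nonneg _)
    refine (Finset.sum_le_sum fun i _ => h1 i).trans ?_
    rw [← Finset.sum_mul, ← EuclideanSpace.real_norm_sq_eq, mul_one_div, div_le_iff₀ hr]
    have := sq_norm_le_of_abs_le hm hmI
    have := mul_le_mul_of_nonneg_left har (Nat.cast_nonneg (α := ℝ) I.card)
    have := mul_le_mul_of_nonneg_left hσ hr.le
    linarith

end Independent

/-! ### Noise that reveals at most one coordinate -/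

section Exclusive

variable {d : ℕ}

/-- At most one coordinate is selected; each one in `I` with probability `r`. -/
noncomputable def exclusive (I : Finset (Fin d)) (r : ℝ) : Measure (Fin d → Bool) :=
  ∑ i ∈ I, ENNReal.ofReal r • Measure.dirac (fun j => decide (j = i))
    + ENNReal.ofReal (1 - I.card * r) • Measure.dirac fun _ => false

variable {I : Finset (Fin d)} {r : ℝ}

theorem isProbabilityMeasure_exclusive (hr : 0 ≤ r) (hr1 : I.card * r ≤ 1) :
    IsProbabilityMeasure (exclusive I r) := by
  refine ⟨?_⟩
  simp only [exclusive, Measure.add_apply, Measure.smul_apply, measure_univ, smul_eq_mul, mul_one,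
    Measure.coe_finsetSum, Finset.sum_apply, Finset.sum_const, nsmul_eq_mul]
  rw [← ENNReal.ofReal_natCast, ← ENNReal.ofReal_mul (Nat.cast_nonneg _),
    ← ENNReal.ofReal_add (by positivity) (sub_nonneg.2 hr1)]
  simp

theorem integral_exclusive (hr : 0 ≤ r) (hr1 : I.card * r ≤ 1) (φ : (Fin d → Bool) → ℝ) :
    ∫ ω, φ ω ∂(exclusive I r) =
      ∑ i ∈ I, r * φ (fun j => decide (j = i)) + (1 - I.card * r) * φ fun _ => false := by
  have hi : ∀ i ∈ I, Integrable φ (ENNReal.ofReal r • Measure.dirac fun j => decide (j = i)) :=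
    fun i _ => Integrable.of_finite.smul_measure ENNReal.ofReal_ne_top
  rw [exclusive, integral_add_measure (integrable_finsetSum_measure.2 hi)
    (Integrable.of_finite.smul_measure ENNReal.ofReal_ne_top), integral_finsetSum_measure hi]
  simp only [integral_smul_measure, integral_dirac, ENNReal.toReal_ofReal hr,
    ENNReal.toReal_ofReal (sub_nonneg.2 hr1), smul_eq_mul]

theorem exclusive_real (hr : 0 ≤ r) (hr1 : I.card * r ≤ 1) {i : Fin d} (hi : i ∈ I) :
    (exclusive I r).real {ω | ω i = true} = r := by
  have hm : MeasurableSet {ω : Fin d → Bool | ω i = true} :=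
    Set.Finite.measurableSet (Set.toFinite _)
  rw [← mul_one (Measure.real _ _), ← smul_eq_mul, ← integral_indicator_const _ hm,
    integral_exclusive hr hr1]
  simp [Set.indicator, hi]

theorem reveal_decide (m : Euc d) (i : Fin d) :
    reveal r (fun j => decide (j = i)) m = EuclideanSpace.single i (m i / r) := by
  ext j
  by_cases hj : j = i
  · subst hj
    simp [reveal]
  · simp [reveal, hj]

theorem reveal_false (m : Euc d) : reveal r (fun _ => false) m = 0 := by
  ext j
  simp [reveal]

/-- Stated for a general ν so as to serve both ν = |⟪e, ·⟫| and ν = ‖·‖. The factor 2 bounds 2^(p-1)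
in the convexity inequality for (x + y)^p. -/
theorem integral_exclusive_rpow_le {p : ℝ} (hp : 1 ≤ p) (hp2 : p ≤ 2) (hr : 0 ≤ r)
    (hr1 : I.card * r ≤ 1) {ν : Euc d → ℝ} (h0 : ∀ x, 0 ≤ ν x) (hz : ν 0 = 0)
    (hsub : ∀ x y, ν (x - y) ≤ ν x + ν y) (m : Euc d) :
    ∫ ω, ν (reveal r ω m - m) ^ p ∂(exclusive I r) ≤
      2 * (∑ i ∈ I, r * ν (EuclideanSpace.single i (m i / r)) ^ p + ν m ^ p) := by
  have hprob := isProbabilityMeasure_exclusive hr hr1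
  have h1 : ∀ ω : Fin d → Bool, ν (reveal r ω m - m) ^ p ≤ 2 * (ν (reveal r ω m) ^ p + ν m ^ p) := by
    intro ω
    refine (Real.rpow_le_rpow (h0 _) (hsub _ _) (by linarith)).trans ?_
    have h2 : (ν (reveal r ω m) + ν m) ^ p ≤
        2 ^ (p - 1) * (ν (reveal r ω m) ^ p + ν m ^ p) := by
      exact_mod_cast NNReal.rpow_add_le_mul_rpow_add_rpow ⟨_, h0 (reveal r ω m)⟩ ⟨_, h0 m⟩ hp
    refine h2.trans ?_
    refine mul_le_mul_of_nonneg_right ?_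
      (add_nonneg (Real.rpow_nonneg (h0 _) _) (Real.rpow_nonneg (h0 _) _))
    exact (Real.rpow_le_rpow_of_exponent_le one_le_two (by linarith)).trans_eq (Real.rpow_one 2)
  refine (integral_mono Integrable.of_finite Integrable.of_finite h1).trans ?_
  rw [integral_const_mul, integral_add Integrable.of_finite Integrable.of_finite, integral_const,
    probReal_univ, one_smul, integral_exclusive hr hr1]
  simp only [reveal_decide, reveal_false, hz]
  rw [Real.zero_rpow (by linarith), mul_zero, add_zero]

theorem mul_div_rpow {p x : ℝ} (hr : 0 < r) (hx : 0 ≤ x) : r * (x / r) ^ p = r ^ (1 - p) * x ^ p := by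
  rw [Real.div_rpow hx hr.le, Real.rpow_sub hr, Real.rpow_one]
  ring

/-- With k = |I|, the revealed part in direction e has moment at most r^(1-p) a^p ∑ |e_i|^p ≤
r^(1-p) a^p k^(1-p/2) = (a√k)^p (kr)^(1-p). The mean obeys the same bound because kr ≤ 1, whence the
4. Passing to the full norm costs only √k^p, which σs√k ≤ σl absorbs. -/
theorem revealNoise_exclusive {a p σs σl : ℝ} (hI : I.Nonempty) (hr : 0 < r)
    (hr1 : I.card * r ≤ 1) (hp : 1 ≤ p) (hp2 : p ≤ 2) (hs : 0 < σs) (ha : 0 ≤ a)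
    (hap : 4 * ((a * √(I.card)) ^ p * (I.card * r) ^ (1 - p)) ≤ σs ^ p)
    (hσ : σs * √(I.card) ≤ σl) : RevealNoise I (exclusive I r) r a p σs σl := by
  have hp0 : 0 ≤ p := by linarith
  have hk1 : (1 : ℝ) ≤ I.card := Nat.one_le_cast.2 hI.card_pos
  have hk : (0 : ℝ) < I.card := by linarith
  have hkr : 1 ≤ (I.card * r) ^ (1 - p) :=
    Real.one_le_rpow_of_pos_of_le_one_of_nonpos (by positivity) hr1 (by linarith)
  have hkp : (√(I.card : ℝ)) ^ p = (I.card : ℝ) ^ (p / 2) := by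
    rw [Real.sqrt_eq_rpow, ← Real.rpow_mul hk.le]
    congr 1
    ring
  have hmp : 0 ≤ (a * √(I.card)) ^ p := by positivity
  have hnorm : ∀ m : Euc d, (∀ i, |m i| ≤ a) → (∀ i ∉ I, m i = 0) → ‖m‖ ≤ a * √(I.card) := by
    intro m hm hmI
    refine le_of_sq_le_sq ?_ (by positivity)
    rw [mul_pow, Real.sq_sqrt hk.le, mul_comm]
    exact sq_norm_le_of_abs_le hm hmI
  refine ⟨hr, fun i hi => exclusive_real hr.le hr1 hi, fun m e hm hmI he => ?_, fun m hm hmI => ?_⟩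
  · refine (integral_exclusive_rpow_le hp hp2 hr.le hr1 (ν := fun x => |⟪e, x⟫|)
      (fun _ => abs_nonneg _) (by simp) (fun x y => by rw [inner_sub_right]; exact abs_sub _ _)
      m).trans ?_
    have h1 : |⟪e, m⟫| ^ p ≤ (a * √(I.card)) ^ p * (I.card * r) ^ (1 - p) := by
      refine (Real.rpow_le_rpow (abs_nonneg _) ?_ hp0).trans (le_mul_of_one_le_right hmp hkr)
      refine (abs_real_inner_le_norm _ _).trans ?_
      rw [he, one_mul]
      exact hnorm m hm hmI
    have h2 : ∑ i ∈ I, r * |⟪e, EuclideanSpace.single i (m i / r)⟫| ^ p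
        ≤ (a * √(I.card)) ^ p * (I.card * r) ^ (1 - p) := by
      have h3 : ∀ i ∈ I, r * |⟪e, EuclideanSpace.single i (m i / r)⟫| ^ p
          ≤ r ^ (1 - p) * a ^ p * |e i| ^ p := by
        intro i _
        have h4 : |⟪e, EuclideanSpace.single i (m i / r)⟫| = |m i| * |e i| / r := by
          rw [EuclideanSpace.inner_single_right, abs_mul, abs_div, abs_of_pos hr]
          simp
          ring
        rw [h4, mul_div_rpow hr (by positivity), Real.mul_rpow (abs_nonneg _) (abs_nonneg _),
          mul_assoc]
        have := Real.rpow_le_rpow (abs_nonneg _) (hm i) hp0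
        gcongr
      refine (Finset.sum_le_sum h3).trans ?_
      rw [← Finset.mul_sum]
      have h5 : ∑ i ∈ I, e i ^ 2 ≤ 1 := by
        have := EuclideanSpace.real_norm_sq_eq e
        rw [he, one_pow] at this
        rw [this]
        exact Finset.sum_le_univ_sum_of_nonneg fun i => sq_nonneg _
      refine (mul_le_mul_of_nonneg_left (sum_abs_rpow_le hp0 hp2 hI h5) (by positivity)).trans_eq ?_
      rw [Real.mul_rpow ha (Real.sqrt_nonneg _), Real.mul_rpow hk.le hr.le, hkp]
      have h6 : (I.card : ℝ) ^ (1 - p / 2) = (I.card : ℝ) ^ (p / 2) * (I.card : ℝ) ^ (1 - p) := by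
        rw [← Real.rpow_add hk]
        congr 1
        ring
      rw [h6]
      ring
    linarith
  · refine (integral_exclusive_rpow_le hp hp2 hr.le hr1 (ν := fun x => ‖x‖)
      (fun _ => norm_nonneg _) norm_zero norm_sub_le m).trans ?_
    have hkp1 : 1 ≤ (√(I.card : ℝ)) ^ p := Real.one_le_rpow (Real.one_le_sqrt.2 hk1) hp0
    have h1 : ‖m‖ ^ p ≤ (a * √(I.card)) ^ p * (I.card * r) ^ (1 - p) * √(I.card) ^ p :=
      ((Real.rpow_le_rpow (norm_nonneg _) (hnorm m hm hmI) hp0).trans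
        (le_mul_of_one_le_right hmp hkr)).trans (le_mul_of_one_le_right (by positivity) hkp1)
    have h2 : ∑ i ∈ I, r * ‖EuclideanSpace.single i (m i / r)‖ ^ p
        ≤ (a * √(I.card)) ^ p * (I.card * r) ^ (1 - p) * √(I.card) ^ p := by
      have h3 : ∀ i ∈ I, r * ‖EuclideanSpace.single i (m i / r)‖ ^ p ≤ r ^ (1 - p) * a ^ p := by
        intro i _
        rw [PiLp.norm_single, Real.norm_eq_abs, abs_div, abs_of_pos hr,
          mul_div_rpow hr (abs_nonneg _)]
        have := Real.rpow_le_rpow (abs_nonneg _) (hm i) hp0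
        gcongr
      refine (Finset.sum_le_card_nsmul I _ _ h3).trans_eq ?_
      rw [nsmul_eq_mul, Real.mul_rpow ha (Real.sqrt_nonneg _), Real.mul_rpow hk.le hr.le, hkp]
      have h6 : (I.card : ℝ) = (I.card : ℝ) ^ (p / 2) * (I.card : ℝ) ^ (1 - p)
          * (I.card : ℝ) ^ (p / 2) := by
        rw [← Real.rpow_add hk, ← Real.rpow_add hk]
        nth_rewrite 1 [← Real.rpow_one (I.card : ℝ)]
        congr 1
        ring
      nth_rewrite 1 [h6]
      ring
    have h3 : 4 * ((a * √(I.card)) ^ p * (I.card * r) ^ (1 - p)) * √(I.card) ^ p ≤ σl ^ p := by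
      refine (mul_le_mul_of_nonneg_right hap (by positivity)).trans ?_
      rw [← Real.mul_rpow hs.le (Real.sqrt_nonneg _)]
      exact Real.rpow_le_rpow (by positivity) hσ hp0
    linarith

/-- The moment is computed exactly, without separating off the mean: for r near 1 the noise nearly
vanishes, which allows a large a when δ is tiny. -/
theorem revealNoise_exclusive_singleton {i : Fin d} {a p σs σl : ℝ} (hr : 0 < r) (hr1 : r ≤ 1)
    (hp : 0 ≤ p) (hs : 0 ≤ σs) (hσ : σs ≤ σl)
    (hap : a ^ p * (r * ((1 - r) / r) ^ p + (1 - r)) ≤ σs ^ p) :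
    RevealNoise {i} (exclusive {i} r) r a p σs σl := by
  have hr1' : (({i} : Finset (Fin d)).card : ℝ) * r ≤ 1 := by simpa using hr1
  have := isProbabilityMeasure_exclusive hr.le hr1'
  have hn : ∀ m : Euc d, (∀ j, |m j| ≤ a) → (∀ j ∉ ({i} : Finset (Fin d)), m j = 0) →
      ∫ ω, ‖reveal r ω m - m‖ ^ p ∂(exclusive {i} r) ≤ σs ^ p := by
    intro m hm hmI
    have hms : m = EuclideanSpace.single i (m i) := by
      ext j
      by_cases hj : j = i
      · subst hj
        simp
      · simp [hj, hmI j (by simpa using hj)]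
    rw [integral_exclusive hr.le hr1', Finset.sum_singleton, reveal_decide, reveal_false]
    have h1 : EuclideanSpace.single i (m i / r) - m
        = EuclideanSpace.single i (m i * ((1 - r) / r)) := by
      nth_rewrite 2 [hms]
      rw [← PiLp.single_sub]
      congr 1
      field_simp
    have h2 : ‖m‖ = |m i| := by
      rw [hms, PiLp.norm_single]
      simp
    have hq : 0 ≤ (1 - r) / r := div_nonneg (sub_nonneg.2 hr1) hr.le
    rw [h1, zero_sub, norm_neg, h2, PiLp.norm_single, Real.norm_eq_abs, abs_mul,
      abs_of_nonneg hq, Real.mul_rpow (abs_nonneg _) hq, Finset.card_singleton, Nat.cast_one,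
      one_mul]
    refine le_trans ?_ hap
    have h3 := Real.rpow_le_rpow (abs_nonneg _) (hm i) hp
    have h4 : 0 ≤ r * ((1 - r) / r) ^ p + (1 - r) :=
      add_nonneg (mul_nonneg hr.le (Real.rpow_nonneg hq _)) (sub_nonneg.2 hr1)
    have := mul_le_mul_of_nonneg_right h3 h4
    linarith
  refine ⟨hr, fun j hj => exclusive_real hr.le hr1' hj, fun m e hm hmI he => ?_,
    fun m hm hmI => (hn m hm hmI).trans (Real.rpow_le_rpow hs hσ hp)⟩
  refine (integral_mono Integrable.of_finite Integrable.of_finite fun ω => ?_).trans (hn m hm hmI)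
  refine Real.rpow_le_rpow (abs_nonneg _) ((abs_real_inner_le_norm _ _).trans_eq ?_) hp
  rw [he, one_mul]

end Exclusive

/-! ### The two rates -/

section Rates

variable {d T : ℕ} {D G p σs σl δ : ℝ}

theorem RevealNoise.le_minimaxError_of_half {I : Finset (Fin d)} {P : Measure (Fin d → Bool)}
    [IsProbabilityMeasure P] {a : ℝ} (hP : RevealNoise I P (1 / (2 * (T : ℝ))) a p σs σl)
    (hp : 0 < p) (hI : I.Nonempty) (hT : 1 ≤ T) (ha : 0 < a) (hD : 0 < D)
    (hG : a * √(I.card) ≤ G) (hδ : 0 ≤ δ) (hδ' : δ < 1 / 10) :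
    ENNReal.ofReal (a * √(I.card) * D / 8) ≤ minimaxError d T D G p σs σl δ := by
  have hT1 : (1 : ℝ) ≤ T := Nat.one_le_cast.2 hT
  have hk : (0 : ℝ) < I.card := Nat.cast_pos.2 hI.card_pos
  have hr : 1 / (2 * (T : ℝ)) ≤ 1 / 2 := by
    rw [div_le_div_iff_of_pos_left one_pos (by linarith) two_pos]
    linarith
  have hpow : (1 : ℝ) / 2 ≤ (1 - 1 / (2 * (T : ℝ))) ^ T := by
    have h := one_add_mul_le_pow (a := -(1 / (2 * (T : ℝ)))) (by linarith) T
    have h' : 1 + (T : ℝ) * -(1 / (2 * (T : ℝ))) = 1 / 2 := by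
      field_simp
      norm_num
    rw [h'] at h
    rwa [sub_eq_add_neg]
  -- With n = ⌊k/8⌋ the requirement reads k/8 + k/10 < k/4, by (1-r)^T ≥ 1/2 and δ < 1/10.
  have hn1 : ((I.card / 8 : ℕ) : ℝ) ≤ I.card / 8 := Nat.cast_div_le
  have hn2 : (I.card : ℝ) / 8 ≤ (I.card / 8 : ℕ) + 1 := by
    have : I.card ≤ 8 * (I.card / 8 + 1) := by omega
    have : (I.card : ℝ) ≤ 8 * ((I.card / 8 : ℕ) + 1) := by exact_mod_cast this
    linarith
  refine le_trans (ENNReal.ofReal_le_ofReal ?_)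
    (hP.le_minimaxError hp hI ha hD hG hδ (I.card / 8) ?_)
  · have hk' : 0 < √(I.card : ℝ) := Real.sqrt_pos.2 hk
    have h1 : a * √(I.card) * D / 8 = a * D / √(I.card) * (I.card / 8) := by
      have := Real.mul_self_sqrt hk.le
      field_simp
      linear_combination this
    rw [h1]
    exact mul_le_mul_of_nonneg_left hn2 (by positivity)
  · have h1 := mul_le_mul_of_nonneg_left hpow hk.le
    have h2 := mul_lt_mul_of_pos_left hδ' hk
    linarith

theorem half_rpow_le {x y γ : ℝ} (hγ : 0 ≤ γ) (hγ2 : γ ≤ 1 / 2) (hx : 0 ≤ x) (hxy : x ≤ 4 * y) :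
    x ^ γ / 2 ≤ y ^ γ := by
  have hy : 0 ≤ y := by linarith
  have h1 : (4 : ℝ) ^ γ ≤ 2 := by
    refine (Real.rpow_le_rpow_of_exponent_le (by norm_num) hγ2).trans_eq ?_
    rw [← Real.sqrt_eq_rpow, show (4 : ℝ) = 2 ^ 2 by norm_num, Real.sqrt_sq two_pos.le]
  have h2 := Real.rpow_le_rpow hx hxy hγ
  rw [Real.mul_rpow (by norm_num) hy] at h2
  have h3 := mul_le_mul_of_nonneg_right h1 (Real.rpow_nonneg hy γ)
  linarith

/-- The part of the lower bound that grows with the effective dimension. -/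
theorem le_minimaxError_dimension (hD : 0 < D) (hG : 0 < G) (hp : 1 < p) (hp2 : p ≤ 2)
    (hs : 0 < σs) (hσ : σs ≤ σl) (hd : σl ^ 2 / σs ^ 2 ≤ (d : ℝ)) (hT : 1 ≤ T) (hδ : 0 < δ)
    (hδ' : δ < 1 / 10) :
    ENNReal.ofReal (D / 64 * min G (σs * (σl ^ 2 / σs ^ 2 / T) ^ (1 - 1 / p))) ≤
      minimaxError d T D G p σs σl δ := by
  have hl : 0 < σl := hs.trans_le hσ
  have hT1 : (1 : ℝ) ≤ T := Nat.one_le_cast.2 hT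
  set Δ := σl ^ 2 / σs ^ 2 with hΔ
  have hΔ1 : 1 ≤ Δ := (one_le_div (by positivity)).2 (pow_le_pow_left₀ hs.le hσ 2)
  set k := ⌊Δ⌋₊ with hk
  have hk1 : 1 ≤ k := Nat.le_floor (by exact_mod_cast hΔ1)
  have hk1' : (1 : ℝ) ≤ k := Nat.one_le_cast.2 hk1
  have hkΔ : (k : ℝ) ≤ Δ := Nat.floor_le (by linarith)
  have hΔk : Δ ≤ 2 * k := by
    have := Nat.lt_floor_add_one Δ
    linarith
  have hkd : k ≤ (Finset.univ : Finset (Fin d)).card := by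
    rw [Finset.card_univ, Fintype.card_fin]
    exact_mod_cast hkΔ.trans hd
  obtain ⟨I, -, hI⟩ := Finset.exists_subset_card_eq hkd
  have hIne : I.Nonempty := Finset.card_pos.1 (by omega)
  have hIc : (I.card : ℝ) = k := by exact_mod_cast hI
  have hkσ : (k : ℝ) * σs ^ 2 ≤ σl ^ 2 := by
    rwa [hΔ, le_div_iff₀ (by positivity)] at hkΔ
  have hγ0 : 0 ≤ 1 - 1 / p := sub_nonneg.2 ((div_le_one (by linarith)).2 hp.le)
  have hγ2 : 1 - 1 / p ≤ 1 / 2 := by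
    have : 1 / 2 ≤ 1 / p := one_div_le_one_div_of_le (by linarith) hp2
    linarith
  set r : ℝ := 1 / (2 * T) with hr
  have hr0 : 0 < r := by positivity
  have hkr : (k : ℝ) * r = k / (2 * T) := by rw [hr, mul_one_div]
  have hΔkr : Δ / T ≤ 4 * (k * r) := by
    rw [hkr, div_le_iff₀ (by linarith)]
    have : 4 * (k / (2 * (T : ℝ))) * T = 2 * k := by
      field_simp
      norm_num
    linarith
  have hsk : 0 < √(k : ℝ) := Real.sqrt_pos.2 (by linarith)
  -- Here μ = a√k is the Lipschitz constant of the hard functions. The 64 is the 8 of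
  -- `le_minimaxError_of_half` times the slack 8 allowed in μ.
  have key : ∀ μ : ℝ, 0 < μ → μ ≤ G → min G (σs * (Δ / T) ^ (1 - 1 / p)) ≤ 8 * μ →
      (∃ P : Measure (Fin d → Bool), IsProbabilityMeasure P ∧ RevealNoise I P r (μ / √k) p σs σl) →
      ENNReal.ofReal (D / 64 * min G (σs * (Δ / T) ^ (1 - 1 / p))) ≤
        minimaxError d T D G p σs σl δ := by
    rintro μ hμ hμG hμ8 ⟨P, hP, hPn⟩
    have hμk : μ / √k * √(I.card) = μ := by rw [hIc, div_mul_cancel₀ _ hsk.ne']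
    refine le_trans (ENNReal.ofReal_le_ofReal ?_) (hPn.le_minimaxError_of_half (by linarith) hIne hT
      (by positivity) hD (hμk.trans_le hμG) hδ.le hδ')
    rw [hμk]
    have := mul_le_mul_of_nonneg_left hμ8 hD.le
    linarith
  rcases le_total T k with hTk | hTk
  · have hkr1 : 1 ≤ 4 * (k * r) := by
      have : (1 : ℝ) ≤ Δ / T := by
        rw [one_le_div (by linarith)]
        exact le_trans (by exact_mod_cast hTk) hkΔ
      linarith
    -- The base 4kr is at least 1, so the exponent 1 - 1/p may be raised to 1/2, the rate that
    -- bounded variance gives.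
    have hA : (Δ / T) ^ (1 - 1 / p) ≤ 2 * √(k * r) := by
      calc (Δ / T) ^ (1 - 1 / p) ≤ (4 * (k * r)) ^ (1 - 1 / p) :=
            Real.rpow_le_rpow (by positivity) hΔkr hγ0
        _ ≤ (4 * (k * r)) ^ (1 / 2 : ℝ) := Real.rpow_le_rpow_of_exponent_le hkr1 hγ2
        _ = 2 * √(k * r) := by
            rw [← Real.sqrt_eq_rpow, Real.sqrt_mul (by norm_num), show (4 : ℝ) = 2 ^ 2 by norm_num,
              Real.sqrt_sq two_pos.le]
    refine key (min G (σs * √(k * r))) (by positivity) (min_le_left _ _) ?_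
      ⟨Measure.pi fun _ => coin r, ?_, ?_⟩
    · rw [mul_min_of_nonneg _ _ (by norm_num)]
      refine min_le_min (by linarith) ?_
      have := mul_le_mul_of_nonneg_left hA hs.le
      have : 0 ≤ σs * √(k * r) := by positivity
      linarith
    all_goals
      have hr1 : r ≤ 1 := (div_le_one (by positivity)).2 (by linarith)
      have := isProbabilityMeasure_coin hr0.le hr1
    · infer_instance
    · refine revealNoise_pi_coin hr0 hr1 (by linarith) hp2 hs hl ?_ (by rwa [hIc])
      rw [div_pow, Real.sq_sqrt (by linarith), div_le_iff₀ (by linarith)]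
      calc (min G (σs * √(k * r))) ^ 2 ≤ (σs * √(k * r)) ^ 2 :=
            pow_le_pow_left₀ (by positivity) (min_le_right _ _) 2
        _ = r * σs ^ 2 * k := by
            rw [mul_pow, Real.sq_sqrt (by positivity)]
            ring
  · have hkr1 : k * r ≤ 1 := by
      rw [hkr, div_le_one (by positivity)]
      have : (k : ℝ) ≤ T := by exact_mod_cast hTk
      linarith
    have hkr0 : 0 < k * r := by positivity
    have hIr : I.card * r ≤ 1 := by rwa [hIc]
    have hA := half_rpow_le hγ0 hγ2 (by positivity) hΔkr
    -- This μ makes μ^p (kr)^(1-p) at most (σs/4)^p; the 4 in front is absorbed because 4 ≤ 4^p.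
    refine key (min G (σs / 4 * (k * r) ^ (1 - 1 / p))) (by positivity) (min_le_left _ _) ?_
      ⟨exclusive I r, isProbabilityMeasure_exclusive hr0.le hIr, ?_⟩
    · rw [mul_min_of_nonneg _ _ (by norm_num)]
      refine min_le_min (by linarith) ?_
      have := mul_le_mul_of_nonneg_left hA hs.le
      linarith
    · refine revealNoise_exclusive hIne hr0 hIr hp.le hp2 hs (by positivity) ?_ ?_
      · rw [hIc, div_mul_cancel₀ _ hsk.ne']
        have h1 : (min G (σs / 4 * (k * r) ^ (1 - 1 / p))) ^ p
            ≤ (σs / 4) ^ p * (k * r) ^ (p - 1) := by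
          refine (Real.rpow_le_rpow (by positivity) (min_le_right _ _) (by linarith)).trans_eq ?_
          rw [Real.mul_rpow (by positivity) (by positivity), ← Real.rpow_mul hkr0.le]
          congr 2
          field_simp
        have h2 : (k * r) ^ (p - 1) * (k * r) ^ (1 - p) = 1 := by
          rw [← Real.rpow_add hkr0]
          simp
        have h3 : 4 * (σs / 4) ^ p ≤ σs ^ p := by
          rw [Real.div_rpow hs.le (by norm_num), ← mul_div_assoc, div_le_iff₀ (by positivity),
            mul_comm]
          refine mul_le_mul_of_nonneg_left ?_ (by positivity)
          nth_rewrite 1 [← Real.rpow_one (4 : ℝ)]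
          exact Real.rpow_le_rpow_of_exponent_le (by norm_num) hp.le
        have h4 := mul_le_mul_of_nonneg_right h1 (Real.rpow_nonneg hkr0.le (1 - p))
        rw [mul_assoc, h2, mul_one] at h4
        linarith
      · rw [hIc]
        refine le_of_sq_le_sq ?_ hl.le
        rw [mul_pow, Real.sq_sqrt (by linarith)]
        linarith

/-- The part of the lower bound that grows with the confidence level. -/
theorem le_minimaxError_confidence (hD : 0 < D) (hG : 0 < G) (hp : 1 < p) (hp2 : p ≤ 2)
    (hs : 0 < σs) (hσ : σs ≤ σl) (hd : 0 < d) (hT : 1 ≤ T) (hδ : 0 < δ) (hδ' : 8 * δ < 1) :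
    ENNReal.ofReal (D / 2 * min G (σs * (Real.log (1 / (8 * δ)) / T) ^ (1 - 1 / p))) ≤
      minimaxError d T D G p σs σl δ := by
  have hT1 : (1 : ℝ) ≤ T := Nat.one_le_cast.2 hT
  have hL : 0 < Real.log (1 / (8 * δ)) :=
    Real.log_pos ((one_lt_div (by positivity)).2 hδ')
  -- Chosen so that q ^ T = 8δ: the single sign is then wrong with probability at least 4δ > δ for
  -- one of its values.
  set s : ℝ := Real.log (1 / (8 * δ)) / T with hsdef
  have hs0 : 0 < s := by positivity
  set q : ℝ := Real.exp (-s) with hq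
  have hq0 : 0 < q := Real.exp_pos _
  have hq1 : q < 1 := by rw [hq, ← Real.exp_zero, Real.exp_lt_exp]; linarith
  have hqT : q ^ T = 8 * δ := by
    rw [hq, ← Real.exp_nat_mul, hsdef, mul_neg, mul_div_cancel₀ _ (by linarith), Real.log_div
      one_ne_zero (by positivity), Real.log_one, zero_sub, neg_neg, Real.exp_log (by positivity)]
  set r : ℝ := 1 - q with hr
  have hr0 : 0 < r := sub_pos.2 hq1
  have hr1 : r ≤ 1 := by linarith
  have hqr : 1 - r = q := by rw [hr, sub_sub_cancel]
  -- Since r / q = exp s - 1.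
  have hsr : s ≤ r / q := by
    rw [le_div_iff₀ hq0]
    have h1 := Real.add_one_le_exp s
    have h2 : Real.exp s * q = 1 := by rw [hq, ← Real.exp_add, add_neg_cancel, Real.exp_zero]
    have h3 := mul_le_mul_of_nonneg_right h1 hq0.le
    rw [h2] at h3
    linarith
  set a : ℝ := min G (σs / 2 * s ^ (1 - 1 / p)) with ha
  have ha0 : 0 < a := by positivity
  have hap : a ^ p ≤ (σs / 2) ^ p * s ^ (p - 1) := by
    refine (Real.rpow_le_rpow ha0.le (min_le_right _ _) (by linarith)).trans_eq ?_
    rw [Real.mul_rpow (by positivity) (by positivity), ← Real.rpow_mul hs0.le]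
    congr 2
    field_simp
  -- Replacing s by r / q cancels the powers of r and leaves q^(2-p), bounded by 1 because p ≤ 2.
  have hsrq : s ^ (p - 1) * (r ^ (1 - p) * q) ≤ 1 := by
    have h1 := Real.rpow_le_rpow hs0.le hsr (by linarith : 0 ≤ p - 1)
    calc s ^ (p - 1) * (r ^ (1 - p) * q) ≤ (r / q) ^ (p - 1) * (r ^ (1 - p) * q) :=
          mul_le_mul_of_nonneg_right h1 (by positivity)
      _ = q ^ (2 - p) := by
          have h2 : r ^ (p - 1) * r ^ (1 - p) = 1 := by
            rw [← Real.rpow_add hr0]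
            simp
          have h3 : q ^ (2 - p) * q ^ (p - 1) = q := by
            rw [← Real.rpow_add hq0]
            norm_num
          rw [Real.div_rpow hr0.le hq0.le]
          have h4 : q ^ (p - 1) ≠ 0 := by positivity
          field_simp
          linear_combination q * h2 - h3
      _ ≤ 1 := Real.rpow_le_one hq0.le hq1.le (by linarith)
  have hσ2 : 2 * (σs / 2) ^ p ≤ σs ^ p := by
    rw [Real.div_rpow hs.le (by norm_num), ← mul_div_assoc, div_le_iff₀ (by positivity), mul_comm]
    refine mul_le_mul_of_nonneg_left ?_ (by positivity)
    nth_rewrite 1 [← Real.rpow_one (2 : ℝ)]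
    exact Real.rpow_le_rpow_of_exponent_le (by norm_num) hp.le
  have hmom : a ^ p * (r * ((1 - r) / r) ^ p + (1 - r)) ≤ σs ^ p := by
    have h1 : r * ((1 - r) / r) ^ p + (1 - r) ≤ 2 * (r ^ (1 - p) * q) := by
      have h2 : q ^ p ≤ q := by
        nth_rewrite 2 [← Real.rpow_one q]
        exact Real.rpow_le_rpow_of_exponent_ge hq0 hq1.le hp.le
      have h3 : 1 ≤ r ^ (1 - p) :=
        Real.one_le_rpow_of_pos_of_le_one_of_nonpos hr0 hr1 (by linarith)
      rw [hqr, mul_div_rpow hr0 hq0.le]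
      have h4 := mul_le_mul_of_nonneg_left h2 (by positivity : 0 ≤ r ^ (1 - p))
      have h5 := mul_le_mul_of_nonneg_right h3 hq0.le
      linarith
    calc _ ≤ (σs / 2) ^ p * s ^ (p - 1) * (2 * (r ^ (1 - p) * q)) :=
          mul_le_mul hap h1 (by rw [hqr]; positivity) (by positivity)
      _ = 2 * (σs / 2) ^ p * (s ^ (p - 1) * (r ^ (1 - p) * q)) := by ring
      _ ≤ 2 * (σs / 2) ^ p := mul_le_of_le_one_right (by positivity) hsrq
      _ ≤ σs ^ p := hσ2
  have hP := revealNoise_exclusive_singleton (i := (⟨0, hd⟩ : Fin d)) hr0 hr1 (by linarith) hs.le hσ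
    hmom
  have := isProbabilityMeasure_exclusive (I := {(⟨0, hd⟩ : Fin d)}) hr0.le (by simpa using hr1)
  refine le_trans (ENNReal.ofReal_le_ofReal ?_) (hP.le_minimaxError (T := T) (by linarith)
    (Finset.singleton_nonempty _) ha0 hD (by simp [ha]) hδ.le 0 ?_)
  · have h1 : min G (σs * s ^ (1 - 1 / p)) ≤ 2 * a := by
      rw [ha, mul_min_of_nonneg _ _ two_pos.le]
      exact min_le_min (by linarith) (by linarith)
    have := mul_le_mul_of_nonneg_left h1 hD.le
    simp only [Finset.card_singleton, Nat.cast_one, Real.sqrt_one, div_one, Nat.cast_zero, zero_add,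
      mul_one]
    linarith
  · rw [hqr, hqT]
    simp only [Finset.card_singleton, Nat.cast_one, Nat.cast_zero]
    linarith

/-- Rewrites the coefficient of the theorem as σs d_eff^(1-1/p), the form in which the dimension
rate appears. -/
theorem rpow_mul_rpow_eq (hs : 0 < σs) (hl : 0 < σl) :
    σs ^ (2 / p - 1) * σl ^ (2 - 2 / p) = σs * (σl ^ 2 / σs ^ 2) ^ (1 - 1 / p) := by
  rw [Real.div_rpow (by positivity) (by positivity), ← Real.rpow_natCast, ← Real.rpow_natCast,
    ← Real.rpow_mul hl.le, ← Real.rpow_mul hs.le]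
  have h1 : σs ^ (2 / p - 1) * σs ^ (((2 : ℕ) : ℝ) * (1 - 1 / p)) = σs := by
    rw [← Real.rpow_add hs]
    conv_rhs => rw [← Real.rpow_one σs]
    congr 1
    push_cast
    ring
  have h2 : ((2 : ℕ) : ℝ) * (1 - 1 / p) = 2 - 2 / p := by
    push_cast
    ring
  rw [h2] at h1 ⊢
  have h3 : σs ^ (2 - 2 / p) ≠ 0 := by positivity
  rw [← mul_div_assoc, eq_div_iff h3]
  linear_combination σl ^ (2 - 2 / p) * h1

end Rates

end StochConvex

/-! ### Combination of the two rates -/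

theorem mainTheorem7 :
    ∃ c : ℝ, 0 < c ∧
      ∀ (D G p σs σl δ : ℝ) (d T : ℕ),
        0 < D → 0 < G → 1 < p → p ≤ 2 → 0 < σs → σs ≤ σl →
        σl ^ 2 / σs ^ 2 ≤ (d : ℝ) → 1 ≤ T → 0 < δ → δ < 1 / 10 →
        ENNReal.ofReal
            (c * min (G * D)
              (min (σs ^ (2 / p - 1) * σl ^ (2 - 2 / p) * D)
                ((σs ^ (2 / p - 1) * σl ^ (2 - 2 / p)
                    + σs * Real.log (1 / (8 * δ)) ^ (1 - 1 / p)) * D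
                  / (T : ℝ) ^ (1 - 1 / p))))
          ≤ StochConvex.minimaxError d T D G p σs σl δ := by
  -- 128 = 2 · 64: a factor 2 for keeping only the larger rate, times the 64 of the dimension bound.
  refine ⟨1 / 128, by norm_num, fun D G p σs σl δ d T hD hG hp hp2 hs hσ hd hT hδ hδ' => ?_⟩
  have hl : 0 < σl := hs.trans_le hσ
  have hT0 : (0 : ℝ) < T := Nat.cast_pos.2 hT
  have hd0 : 0 < d := by
    have : (0 : ℝ) < d := lt_of_lt_of_le (by positivity) hd
    exact_mod_cast this
  have hL : 0 ≤ Real.log (1 / (8 * δ)) :=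
    Real.log_nonneg ((one_le_div (by positivity)).2 (by linarith))
  have h1 := StochConvex.le_minimaxError_dimension hD hG hp hp2 hs hσ hd hT hδ hδ'
  have h2 := StochConvex.le_minimaxError_confidence hD hG hp hp2 hs hσ hd0 hT hδ (by linarith)
  rw [StochConvex.rpow_mul_rpow_eq hs hl]
  rw [Real.div_rpow (by positivity) hT0.le] at h1
  rw [Real.div_rpow hL hT0.le] at h2
  set Δ := (σl ^ 2 / σs ^ 2) ^ (1 - 1 / p)
  set L := Real.log (1 / (8 * δ)) ^ (1 - 1 / p)
  set τ := (T : ℝ) ^ (1 - 1 / p)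
  have hsum : (σs * Δ + σs * L) * D / τ = σs * (Δ / τ) * D + σs * (L / τ) * D := by ring
  -- The middle term of the minimum is discarded; the bound holds without it.
  have hmin : min (G * D) (min (σs * Δ * D) ((σs * Δ + σs * L) * D / τ)) ≤
      min (G * D) (σs * (Δ / τ) * D + σs * (L / τ) * D) := by
    rw [hsum]
    exact min_le_min_left _ (min_le_right _ _)
  rcases le_total (σs * (L / τ)) (σs * (Δ / τ)) with h | h
  · refine le_trans (ENNReal.ofReal_le_ofReal ?_) h1
    have h3 := mul_le_mul_of_nonneg_right h hD.le
    have h4 : min (G * D) (σs * (Δ / τ) * D + σs * (L / τ) * D) ≤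
        2 * (min G (σs * (Δ / τ)) * D) := by
      rw [min_mul_of_nonneg _ _ hD.le, mul_min_of_nonneg _ _ two_pos.le]
      exact min_le_min (by linarith [mul_pos hG hD]) (by linarith)
    linarith
  · refine le_trans (ENNReal.ofReal_le_ofReal ?_) h2
    have h3 := mul_le_mul_of_nonneg_right h hD.le
    have h4 : min (G * D) (σs * (Δ / τ) * D + σs * (L / τ) * D) ≤
        2 * (min G (σs * (L / τ)) * D) := by
      rw [min_mul_of_nonneg _ _ hD.le, mul_min_of_nonneg _ _ two_pos.le]
      exact min_le_min (by linarith [mul_pos hG hD]) (by linarith)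
    have h5 : 0 ≤ min G (σs * (L / τ)) * D := by positivity
    linarith
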